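/- For $c>0$ let $Lv(c)$ be the one-sided Lévy distribution, i.e. the law on $\mathbb R$ with density $f(x;c)=\sqrt{c/(2\pi)}\,x^{-3/2}e^{-c/(2x)}$ for $x>0$ and $f(x;c)=0$ for $x\le 0$. Fix a quantile split $0\le a<b<1$ and put $\mu_{Lv(1)}(a,b):=\mathbb E[W\mid F_W^{-1}(a)\le W\le F_W^{-1}(b)]$ for $W\sim Lv(1)$, where $F_W^{-1}(p)=\inf\{x\in\mathbb R: F_W(x)\ge p\}$ is the generalised inverse of the distribution function $F_W$ of $W$. For a sample $X_1,\dots,X_n$ let $Y_i=1/X_i$ and $Z_i=\ln Y_i$, let $\bar Y_n,\bar Z_n$ be the sample means of $(Y_i)_{i=1}^n$ and $(Z_i)_{i=1}^n$, let $X_{(1)}\le\dots\le X_{(n)}$ be the order statistics, let $[\cdot]$ denote the integer part, and define $$\hat c_{\mathrm{MLE}}=\frac1{\bar Y_n},\qquad \hat c_{\mathrm{COV}}=\frac{2n}{\sum_{i=1}^n(Y_i-\bar Y_n)(Z_i-\bar Z_n)},\qquad \hat c_{\mathrm{QCM}}(a,b)=\frac{1}{\mu_{Lv(1)}(a,b)}\cdot\frac1{[nb]-[na]}\sum_{i=[na]+1}^{[nb]}X_{(i)},$$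 $$T_n=\sqrt n\left(\frac{\hat c_{\mathrm{COV}}+\hat c_{\mathrm{QCM}}(a,b)}{2\,\hat c_{\mathrm{MLE}}}-1\right).$$ Then there is a constant $\tau_T>0$, depending only on $a$ and $b$ (in particular not on $c$), such that for every $c>0$ and every sequence $X_1,X_2,\dots$ of i.i.d. random variables with law $Lv(c)$, $$T_n\xrightarrow{d}\mathcal N(0,\tau_T^2)\qquad\text{as } n\to\infty .$$ -/

import Mathlib

open MeasureTheory ProbabilityTheory Filter Topology
open scoped NNReal

namespace LevyGoF

/-- The density of the one-sided Lévy distribution `Lv(c)`. -/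
noncomputable def levyPDF (c x : ℝ) : ℝ :=
  if 0 ≤ x then Real.sqrt (c / (2 * Real.pi)) * x ^ (-(3 / 2) : ℝ) * Real.exp (-(c / (2 * x)))
  else 0

/-- The one-sided Lévy distribution `Lv(c)` with scale parameter `c`, as a measure on `ℝ`. -/
noncomputable def levyMeasure (c : ℝ) : Measure ℝ :=
  volume.withDensity (fun x => ENNReal.ofReal (levyPDF c x))

/-- The generalised inverse `inf {x ∈ ℝ | F(x) ≥ p}` of the distribution function `F` of `ν`,
with values in the extended reals (so that it is `-∞` at `p = 0`). -/
noncomputable def quantile (ν : Measure ℝ) (p : ℝ) : EReal :=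
  sInf ((fun x : ℝ => (x : EReal)) '' {x : ℝ | p ≤ cdf ν x})

/-- The set of values `x` with `F⁻¹(a) ≤ x ≤ F⁻¹(b)`. -/
def quantileSet (ν : Measure ℝ) (a b : ℝ) : Set ℝ :=
  {x : ℝ | quantile ν a ≤ (x : EReal) ∧ (x : EReal) ≤ quantile ν b}

/-- The quantile conditional mean `E[X | F⁻¹(a) ≤ X ≤ F⁻¹(b)]` for `X` with law `ν`. -/
noncomputable def qcm (ν : Measure ℝ) (a b : ℝ) : ℝ :=
  ∫ x, x ∂(cond ν (quantileSet ν a b))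

/-- The order statistics of a sample: `orderStat x j` is the `(j + 1)`-st smallest value. -/
noncomputable def orderStat {n : ℕ} (x : Fin n → ℝ) : Fin n → ℝ :=
  x ∘ Tuple.sort x

/-- The sample quantile conditional mean: the average of the order statistics whose (one-based)
ranks run from `[na] + 1` to `[nb]`. The zero-based index `j` has rank `j + 1`. -/
noncomputable def sampleQCM {n : ℕ} (a b : ℝ) (x : Fin n → ℝ) : ℝ :=
  1 / ((⌊(n : ℝ) * b⌋₊ : ℝ) - (⌊(n : ℝ) * a⌋₊ : ℝ)) *
    ∑ j ∈ Finset.univ.filter (fun j : Fin n =>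
        ⌊(n : ℝ) * a⌋₊ + 1 ≤ (j : ℕ) + 1 ∧ (j : ℕ) + 1 ≤ ⌊(n : ℝ) * b⌋₊),
      orderStat x j

/-- The sample mean. -/
noncomputable def sampleMean {n : ℕ} (x : Fin n → ℝ) : ℝ :=
  (∑ i, x i) / n

/-- The quantile-conditional-mean estimator of the scale. -/
noncomputable def cQCM {n : ℕ} (a b : ℝ) (x : Fin n → ℝ) : ℝ :=
  sampleQCM a b x / qcm (levyMeasure 1) a b

/-- The maximum likelihood estimator of the scale, `1 / mean(Y)` with `Y = 1 / X`. -/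
noncomputable def cMLE {n : ℕ} (x : Fin n → ℝ) : ℝ :=
  1 / sampleMean (fun i => 1 / x i)

/-- The covariance-based estimator of the scale, built from `Y = 1 / X` and `Z = ln Y`. -/
noncomputable def cCOV {n : ℕ} (x : Fin n → ℝ) : ℝ :=
  let y : Fin n → ℝ := fun i => 1 / x i
  let z : Fin n → ℝ := fun i => Real.log (y i)
  2 * n / ∑ i, (y i - sampleMean y) * (z i - sampleMean z)

/-- The ensemble scale ratio statistic of a sample of size `n`. -/
noncomputable def ensembleStat {n : ℕ} (a b : ℝ) (x : Fin n → ℝ) : ℝ :=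
  Real.sqrt n * ((cCOV x + cQCM a b x) / (2 * cMLE x) - 1)

end LevyGoF

namespace LevyGoF

/-! Each of the three estimators is multiplied by `c` when the sample is, so the statistic is scale
invariant and only `Lv(1)` matters. There `Y = 1/W` has the Gamma(1/2, 1/2) law, with `E Y = 1` and
`Cov(Y, ln Y) = 2`.

With S the sample covariance and Q the QCM estimator, `T_n = √n((2/S + Q)Ȳ/2 - 1)`. Linearising at
`S = 2`, `Q = Ȳ = 1` writes `T_n` as the empirical process of one square-integrable function,
`influence`, plus o_P(1) (`negligibleInProb_ensembleStat_sub`); the central limit theorem and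
Slutsky's lemma conclude.

The delicate term is Q, an average of order statistics. The sum of the `k` smallest values is the
maximum over `q` of `kq - ∑ (q - x_i)⁺`. Evaluated at the population quantile instead, this loses at
most `ε|N - k|`, where N counts the values up to `q` and `ε` bounds the distance of the relevant
order statistics from `q`. As `N - k` is of order `√n` and `ε` is arbitrary, the loss is o_P(√n)
(`negligibleInProb_lowerSumDefect`). What remains is a sum of bounded i.i.d. shortfalls.

The limit variance is positive because `influence` tends to `-∞` at infinity, hence is not almost
surely constant (`variance_influence_pos`). -/

/-! ### Order statistics and sums of the smallest values -/

theorem monotone_orderStat {n : ℕ} (x : Fin n → ℝ) : Monotone (orderStat x) :=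
  Tuple.monotone_sort x

theorem sum_comp_orderStat {n : ℕ} (x : Fin n → ℝ) (φ : ℝ → ℝ) :
    ∑ j, φ (orderStat x j) = ∑ i, φ (x i) :=
  Equiv.sum_comp (Tuple.sort x) fun i => φ (x i)

/-- Turns events about order statistics into counts, to which the law of large numbers applies. The
inequality is strict because indices start at zero. -/
theorem orderStat_le_iff {n : ℕ} (x : Fin n → ℝ) (j : Fin n) (t : ℝ) :
    orderStat x j ≤ t ↔ (j : ℝ) < ∑ i, if x i ≤ t then (1 : ℝ) else 0 := by
  rw [← Tuple.lt_card_le_iff_apply_le_of_monotone (monotone_orderStat x),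
    ← sum_comp_orderStat x (fun y => if y ≤ t then (1 : ℝ) else 0), Finset.sum_boole]
  norm_cast

/-- The permutation that sorts `x` also sorts `c * x`, and the sorted tuple is the same for every
sorting permutation, ties included. -/
theorem orderStat_const_mul {n : ℕ} (x : Fin n → ℝ) {c : ℝ} (hc : 0 ≤ c) :
    orderStat (fun i => c * x i) = fun j => c * orderStat x j := by
  have h : Monotone ((fun i => c * x i) ∘ Tuple.sort x) := fun i j hij =>
    mul_le_mul_of_nonneg_left (monotone_orderStat x hij) hc
  exact (Tuple.comp_sort_eq_comp_iff_monotone.2 h).symm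

theorem measurable_orderStat {n : ℕ} (j : Fin n) :
    Measurable fun x : Fin n → ℝ => orderStat x j := by
  refine measurable_of_Iic fun t => ?_
  have : (fun x : Fin n → ℝ => orderStat x j) ⁻¹' Set.Iic t =
      {x | (j : ℝ) < ∑ i, if x i ≤ t then (1 : ℝ) else 0} := by
    ext x
    exact orderStat_le_iff x j t
  rw [this]
  refine measurableSet_lt measurable_const (Finset.measurable_sum _ fun i _ => ?_)
  exact Measurable.ite (measurableSet_le (measurable_pi_apply i) measurable_const)
    measurable_const measurable_const

/-- The error in the variational formula for the sum of the `k` smallest sample values when it is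
evaluated at `q` instead of at the optimal point, the `k`-th order statistic. -/
noncomputable def lowerSumDefect {n : ℕ} (x : Fin n → ℝ) (q : ℝ) (k : ℕ) : ℝ :=
  (∑ j : Fin n, if (j : ℕ) < k then orderStat x j else 0) - k * q + ∑ i, max (q - x i) 0

theorem measurable_lowerSumDefect {n : ℕ} (q : ℝ) (k : ℕ) :
    Measurable fun x : Fin n → ℝ => lowerSumDefect x q k := by
  unfold lowerSumDefect
  refine Measurable.add (Measurable.sub (Finset.measurable_sum _ fun j _ => ?_) (by fun_prop))
    (by fun_prop)
  split_ifs
  · exact measurable_orderStat j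
  · fun_prop

theorem sum_ite_val_lt {n k : ℕ} (hk : k ≤ n) :
    ∑ j : Fin n, (if (j : ℕ) < k then (1 : ℝ) else 0) = k := by
  rw [Finset.sum_boole, Fin.card_filter_val_lt, min_eq_right hk]

/-- In the defect, indices below `k` contribute `(x_(j) - q)⁺` and the others `(q - x_(j))⁺`. Only
the `|N - k|` indices between the two counts can contribute, and `h₁`, `h₂` bound each such term by
`ε`. -/
theorem abs_lowerSumDefect_le {n k : ℕ} (hk : k ≤ n) (x : Fin n → ℝ) (q : ℝ) {ε : ℝ}
    (hε : 0 ≤ ε) (h₁ : ∑ i, (if x i ≤ q - ε then (1 : ℝ) else 0) ≤ k)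
    (h₂ : k ≤ ∑ i, if x i ≤ q + ε then (1 : ℝ) else 0) :
    |lowerSumDefect x q k| ≤ ε * |(∑ i, if x i ≤ q then (1 : ℝ) else 0) - k| := by
  set N : ℝ := ∑ i, if x i ≤ q then (1 : ℝ) else 0 with hN
  have hN' : N = ∑ j, if orderStat x j ≤ q then (1 : ℝ) else 0 :=
    (sum_comp_orderStat x fun y => if y ≤ q then (1 : ℝ) else 0).symm
  have hD : lowerSumDefect x q k = ∑ j : Fin n, if (j : ℕ) < k then max (orderStat x j - q) 0
      else max (q - orderStat x j) 0 := by
    rw [lowerSumDefect, ← sum_comp_orderStat x (fun y => max (q - y) 0), ← sum_ite_val_lt hk,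
      Finset.sum_mul, ← Finset.sum_sub_distrib, ← Finset.sum_add_distrib]
    refine Finset.sum_congr rfl fun j _ => ?_
    split_ifs
    · rcases le_total (orderStat x j) q with h | h
      · rw [max_eq_left (by linarith), max_eq_right (by linarith)]; ring
      · rw [max_eq_right (by linarith), max_eq_left (by linarith)]; ring
    · ring
  have hle : ∀ j : Fin n, (if (j : ℕ) < k then max (orderStat x j - q) 0
      else max (q - orderStat x j) 0) ≤ ε * |(if orderStat x j ≤ q then (1 : ℝ) else 0) -
        if (j : ℕ) < k then 1 else 0| := by
    intro j
    by_cases hj : (j : ℕ) < k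
    · have hj' : (j : ℝ) < k := by exact_mod_cast hj
      have := (orderStat_le_iff x j (q + ε)).2 (hj'.trans_le h₂)
      by_cases hq : orderStat x j ≤ q
      · simp [hj, hq]
      · simpa [hj, hq, hε, add_comm ε] using this
    · have hj' : (k : ℝ) ≤ j := by exact_mod_cast not_lt.1 hj
      have : ¬ orderStat x j ≤ q - ε := fun h =>
        ((orderStat_le_iff x j (q - ε)).1 h).not_ge (h₁.trans hj')
      by_cases hq : orderStat x j ≤ q
      · simp [hj, hq]; linarith
      · simp [hj, hq]; linarith
  have hnonneg : 0 ≤ lowerSumDefect x q k := by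
    rw [hD]
    refine Finset.sum_nonneg fun j _ => ?_
    split_ifs <;> exact le_max_right _ _
  rw [abs_of_nonneg hnonneg, hD]
  refine (Finset.sum_le_sum fun j _ => hle j).trans ?_
  rw [← Finset.mul_sum]
  refine mul_le_mul_of_nonneg_left ?_ hε
  rw [hN', ← sum_ite_val_lt hk, ← Finset.sum_sub_distrib]
  refine le_of_eq ?_
  have hiff : ∀ j : Fin n, orderStat x j ≤ q ↔ (j : ℝ) < N := fun j => orderStat_le_iff x j q
  -- Both indicators cut out initial segments of indices, so their differences share one sign and
  -- the absolute values sum to `|N - k|`.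
  rcases le_total N k with h | h
  · have hs : ∀ j : Fin n, (if orderStat x j ≤ q then (1 : ℝ) else 0) -
        (if (j : ℕ) < k then 1 else 0) ≤ 0 := by
      intro j
      have : orderStat x j ≤ q → (j : ℕ) < k := fun hj => by
        exact_mod_cast ((hiff j).1 hj).trans_le h
      split_ifs with h₁ h₂ <;> first | exact absurd (this h₁) h₂ | norm_num
    rw [abs_of_nonpos (Finset.sum_nonpos fun j _ => hs j), ← Finset.sum_neg_distrib]
    exact Finset.sum_congr rfl fun j _ => abs_of_nonpos (hs j)
  · have hs : ∀ j : Fin n, 0 ≤ (if orderStat x j ≤ q then (1 : ℝ) else 0) -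
        (if (j : ℕ) < k then 1 else 0) := by
      intro j
      have : (j : ℕ) < k → orderStat x j ≤ q := fun hj =>
        (hiff j).2 ((Nat.cast_lt.2 hj).trans_le h)
      split_ifs with h₁ h₂ h₂ <;> first | exact absurd (this h₂) h₁ | norm_num
    rw [abs_of_nonneg (Finset.sum_nonneg fun j _ => hs j)]
    exact Finset.sum_congr rfl fun j _ => abs_of_nonneg (hs j)

/-- A block of ranks is a difference of two sums of smallest values, each expanded at its own level.
The identity is exact; later `p` and `q` are the population quantiles. -/
theorem sum_orderStat_between {n k l : ℕ} (hkl : k ≤ l) (x : Fin n → ℝ) (p q : ℝ) :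
    ∑ j ∈ Finset.univ.filter (fun j : Fin n => k + 1 ≤ (j : ℕ) + 1 ∧ (j : ℕ) + 1 ≤ l),
        orderStat x j =
      l * q - k * p - (∑ i, max (q - x i) 0 - ∑ i, max (p - x i) 0) +
        (lowerSumDefect x q l - lowerSumDefect x p k) := by
  have : ∑ j ∈ Finset.univ.filter (fun j : Fin n => k + 1 ≤ (j : ℕ) + 1 ∧ (j : ℕ) + 1 ≤ l),
        orderStat x j = (∑ j : Fin n, if (j : ℕ) < l then orderStat x j else 0) -
          ∑ j : Fin n, if (j : ℕ) < k then orderStat x j else 0 := by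
    rw [Finset.sum_filter, ← Finset.sum_sub_distrib]
    refine Finset.sum_congr rfl fun j _ => ?_
    split_ifs <;> first | omega | simp
  rw [this, lowerSumDefect, lowerSumDefect]
  ring

/-! ### Scale equivariance of the estimators -/

theorem sampleQCM_const_mul {n : ℕ} (a b : ℝ) (x : Fin n → ℝ) {c : ℝ} (hc : 0 ≤ c) :
    sampleQCM a b (fun i => c * x i) = c * sampleQCM a b x := by
  simp only [sampleQCM, orderStat_const_mul x hc, ← Finset.mul_sum]
  ring

theorem sampleMean_const_mul {n : ℕ} (x : Fin n → ℝ) (c : ℝ) :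
    sampleMean (fun i => c * x i) = c * sampleMean x := by
  simp only [sampleMean, ← Finset.mul_sum, mul_div_assoc]

theorem sampleMean_add_const {n : ℕ} (hn : n ≠ 0) (x : Fin n → ℝ) (c : ℝ) :
    sampleMean (fun i => x i + c) = sampleMean x + c := by
  have : (n : ℝ) ≠ 0 := by exact_mod_cast hn
  simp only [sampleMean, Finset.sum_add_distrib, Finset.sum_const, Finset.card_univ,
    Fintype.card_fin, nsmul_eq_mul]
  field_simp

theorem cMLE_const_mul {n : ℕ} (x : Fin n → ℝ) (c : ℝ) :
    cMLE (fun i => c * x i) = c * cMLE x := by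
  have : (fun i => 1 / (c * x i)) = fun i => c⁻¹ * (1 / x i) := by
    ext i
    rw [one_div, mul_inv, one_div]
  rw [cMLE, this, sampleMean_const_mul, cMLE, one_div, mul_inv, inv_inv, one_div]

/-- Scaling divides `Y` by `c` and shifts `ln Y` by `-ln c`; centring removes the shift. -/
theorem cCOV_const_mul {n : ℕ} (x : Fin n → ℝ) {c : ℝ} (hc : c ≠ 0) (hx : ∀ i, x i ≠ 0) :
    cCOV (fun i => c * x i) = c * cCOV x := by
  rcases eq_or_ne n 0 with rfl | hn
  · simp [cCOV]
  have h₁ : (fun i => 1 / (c * x i)) = fun i => c⁻¹ * (1 / x i) := by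
    ext i
    rw [one_div, mul_inv, one_div]
  have h₂ : (fun i => Real.log (1 / (c * x i))) =
      fun i => Real.log (1 / x i) + -Real.log c := by
    ext i
    rw [one_div, Real.log_inv, Real.log_mul hc (hx i), one_div, Real.log_inv]
    ring
  simp only [cCOV]
  rw [h₁, h₂, sampleMean_const_mul, sampleMean_add_const hn]
  have h₃ : ∀ i, (c⁻¹ * (1 / x i) - c⁻¹ * sampleMean fun i => 1 / x i) *
      (Real.log (1 / (c * x i)) - (sampleMean (fun i => Real.log (1 / x i)) + -Real.log c)) =
      c⁻¹ * ((1 / x i - sampleMean fun i => 1 / x i) *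
        (Real.log (1 / x i) - sampleMean fun i => Real.log (1 / x i))) := by
    intro i
    rw [congrFun h₂ i]
    ring
  have h₄ : ∀ i, 1 / (c * x i) = c⁻¹ * (1 / x i) := congrFun h₁
  simp only [← h₄] at h₃ ⊢
  rw [Finset.sum_congr rfl fun i _ => h₃ i, ← Finset.mul_sum]
  rw [div_mul_eq_div_div_swap, div_inv_eq_mul, mul_comm]

/-- The ensemble scale ratio statistic is scale invariant. -/
theorem ensembleStat_const_mul {n : ℕ} (a b : ℝ) (x : Fin n → ℝ) {c : ℝ} (hc : 0 < c)
    (hx : ∀ i, x i ≠ 0) :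
    ensembleStat a b (fun i => c * x i) = ensembleStat a b x := by
  rw [ensembleStat, ensembleStat, cCOV_const_mul x hc.ne' hx, cMLE_const_mul, cQCM, cQCM,
    sampleQCM_const_mul a b x hc.le, mul_div_assoc, ← mul_add, mul_left_comm,
    mul_div_mul_left _ _ hc.ne']

theorem measurable_ensembleStat {n : ℕ} (a b : ℝ) :
    Measurable fun x : Fin n → ℝ => ensembleStat a b x := by
  unfold ensembleStat cCOV cQCM cMLE sampleQCM sampleMean
  have := fun j : Fin n => measurable_orderStat j
  fun_prop

/-! ### Calculus of O_P(1) and o_P(1) -/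

section Stochastic

variable {Ω : Type*} [MeasurableSpace Ω] {P : Measure Ω}

/-- Boundedness in probability (tightness) of a sequence of real random variables. -/
def BoundedInProb (P : Measure Ω) (f : ℕ → Ω → ℝ) : Prop :=
  ∀ ε : ℝ, 0 < ε → ∃ M : ℝ, 0 < M ∧ ∀ᶠ n in atTop, P.real {ω | M ≤ |f n ω|} ≤ ε

/-- Convergence to zero in probability of a sequence of real random variables. -/
def NegligibleInProb (P : Measure Ω) (f : ℕ → Ω → ℝ) : Prop :=
  ∀ ε : ℝ, 0 < ε → ∀ δ : ℝ, 0 < δ → ∀ᶠ n in atTop, P.real {ω | ε ≤ |f n ω|} ≤ δ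

theorem negligibleInProb_iff [IsProbabilityMeasure P] {f : ℕ → Ω → ℝ} :
    NegligibleInProb P f ↔ TendstoInMeasure P f atTop 0 := by
  rw [tendstoInMeasure_iff_measureReal_norm]
  refine forall₂_congr fun ε _ => ?_
  simp only [Pi.zero_apply, sub_zero, Real.norm_eq_abs]
  constructor
  · intro h
    refine tendsto_order.2 ⟨fun y hy => .of_forall fun n => hy.trans_le measureReal_nonneg,
      fun y hy => ?_⟩
    filter_upwards [h (y / 2) (half_pos hy)] with n hn
    linarith
  · intro h δ hδ
    exact h.eventually_le_const hδ

theorem NegligibleInProb.boundedInProb {f : ℕ → Ω → ℝ} (h : NegligibleInProb P f) :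
    BoundedInProb P f :=
  fun ε hε => ⟨1, one_pos, h 1 one_pos ε hε⟩

theorem measureReal_le_add_of_subset [IsProbabilityMeasure P] {s t u : Set Ω} {x y z : ℝ}
    (hs : s ⊆ t ∪ u) (ht : P.real t ≤ x) (hu : P.real u ≤ y) (hz : x + y ≤ z) :
    P.real s ≤ z :=
  ((measureReal_mono hs).trans (measureReal_union_le t u)).trans
    ((add_le_add ht hu).trans hz)

theorem BoundedInProb.add [IsProbabilityMeasure P] {f g : ℕ → Ω → ℝ} (hf : BoundedInProb P f)
    (hg : BoundedInProb P g) : BoundedInProb P fun n ω => f n ω + g n ω := by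
  intro ε hε
  obtain ⟨M, hM, hM'⟩ := hf (ε / 2) (half_pos hε)
  obtain ⟨N, hN, hN'⟩ := hg (ε / 2) (half_pos hε)
  refine ⟨M + N, add_pos hM hN, ?_⟩
  filter_upwards [hM', hN'] with n h₁ h₂
  refine measureReal_le_add_of_subset ?_ h₁ h₂ (by linarith)
  intro ω hω
  simp only [Set.mem_union, Set.mem_ofPred_eq] at hω ⊢
  by_contra! h
  linarith [abs_add_le (f n ω) (g n ω)]

theorem NegligibleInProb.add [IsProbabilityMeasure P] {f g : ℕ → Ω → ℝ}
    (hf : NegligibleInProb P f) (hg : NegligibleInProb P g) :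
    NegligibleInProb P fun n ω => f n ω + g n ω := by
  intro ε hε δ hδ
  filter_upwards [hf (ε / 2) (half_pos hε) (δ / 2) (half_pos hδ),
    hg (ε / 2) (half_pos hε) (δ / 2) (half_pos hδ)] with n h₁ h₂
  refine measureReal_le_add_of_subset ?_ h₁ h₂ (by linarith)
  intro ω hω
  simp only [Set.mem_union, Set.mem_ofPred_eq] at hω ⊢
  by_contra! h
  linarith [abs_add_le (f n ω) (g n ω)]

theorem BoundedInProb.mul_negligible [IsProbabilityMeasure P] {f g : ℕ → Ω → ℝ}
    (hf : BoundedInProb P f) (hg : NegligibleInProb P g) :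
    NegligibleInProb P fun n ω => f n ω * g n ω := by
  intro ε hε δ hδ
  obtain ⟨M, hM, hM'⟩ := hf (δ / 2) (half_pos hδ)
  filter_upwards [hM', hg (ε / M) (div_pos hε hM) (δ / 2) (half_pos hδ)] with n h₁ h₂
  refine measureReal_le_add_of_subset ?_ h₁ h₂ (by linarith)
  intro ω hω
  simp only [Set.mem_union, Set.mem_ofPred_eq] at hω ⊢
  by_contra! h
  rw [abs_mul] at hω
  have : |f n ω| * |g n ω| < M * (ε / M) :=
    mul_lt_mul'' h.1 h.2 (abs_nonneg _) (abs_nonneg _)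
  rw [mul_div_cancel₀ _ hM.ne'] at this
  linarith

theorem boundedInProb_of_abs_le [IsProbabilityMeasure P] {f : ℕ → Ω → ℝ} {C : ℝ}
    (h : ∀ᶠ n in atTop, ∀ ω, |f n ω| ≤ C) : BoundedInProb P f := by
  intro ε hε
  refine ⟨|C| + 1, by positivity, ?_⟩
  filter_upwards [h] with n hn
  have : {ω | |C| + 1 ≤ |f n ω|} = ∅ := by
    ext ω
    simp only [Set.mem_ofPred_eq, Set.mem_empty_iff_false, iff_false, not_le]
    linarith [hn ω, le_abs_self C]
  rw [this, measureReal_empty]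
  exact hε.le

theorem NegligibleInProb.const_mul [IsProbabilityMeasure P] {f : ℕ → Ω → ℝ}
    (hf : NegligibleInProb P f) (C : ℝ) : NegligibleInProb P fun n ω => C * f n ω :=
  BoundedInProb.mul_negligible (f := fun _ _ => C)
    (boundedInProb_of_abs_le (.of_forall fun _ _ => le_rfl)) hf

theorem BoundedInProb.const_mul [IsProbabilityMeasure P] {f : ℕ → Ω → ℝ}
    (hf : BoundedInProb P f) (C : ℝ) : BoundedInProb P fun n ω => C * f n ω := by
  intro ε hε
  obtain ⟨M, hM, h⟩ := hf ε hε
  refine ⟨(|C| + 1) * M, by positivity, ?_⟩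
  filter_upwards [h] with n hn
  refine (measureReal_mono fun ω hω => ?_).trans hn
  simp only [Set.mem_ofPred_eq, abs_mul] at hω ⊢
  nlinarith [abs_nonneg C, abs_nonneg (f n ω)]

theorem NegligibleInProb.congr [IsProbabilityMeasure P] {f g : ℕ → Ω → ℝ}
    (hf : NegligibleInProb P f) (h : ∀ᶠ n in atTop, ∀ᵐ ω ∂P, f n ω = g n ω) :
    NegligibleInProb P g := by
  intro ε hε δ hδ
  filter_upwards [hf ε hε δ hδ, h] with n h₁ h₂
  refine le_trans (le_of_eq (measureReal_congr ?_)) h₁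
  refine eventuallyEq_set.2 ?_
  filter_upwards [h₂] with ω hω
  simp only [hω]

theorem negligibleInProb_of_ae_tendsto [IsProbabilityMeasure P] {f : ℕ → Ω → ℝ}
    (hm : ∀ n, AEMeasurable (f n) P) (h : ∀ᵐ ω ∂P, Tendsto (fun n => f n ω) atTop (𝓝 0)) :
    NegligibleInProb P f :=
  negligibleInProb_iff.2
    (tendstoInMeasure_of_tendsto_ae (fun n => (hm n).aestronglyMeasurable) h)

theorem negligibleInProb_of_tendsto [IsProbabilityMeasure P] {u : ℕ → ℝ}
    (h : Tendsto u atTop (𝓝 0)) : NegligibleInProb P fun n (_ : Ω) => u n :=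
  negligibleInProb_of_ae_tendsto (fun _ => aemeasurable_const) (ae_of_all _ fun _ => h)

/-- A sequence which is almost surely `o(g n)`, with `g n` bounded in probability, is negligible in
probability. -/
theorem negligibleInProb_of_ae_isLittleO [IsProbabilityMeasure P] {f g : ℕ → Ω → ℝ}
    (hf : ∀ n, AEMeasurable (f n) P) (hg : ∀ n, AEMeasurable (g n) P) (hb : BoundedInProb P g)
    (h : ∀ ε : ℝ, 0 < ε → ∀ᵐ ω ∂P, ∀ᶠ n in atTop, |f n ω| ≤ ε * |g n ω|) :
    NegligibleInProb P f := by
  have hr : NegligibleInProb P fun n ω => f n ω / (1 + |g n ω|) := by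
    refine negligibleInProb_of_ae_tendsto
      (fun n => (hf n).div ((hg n).abs.const_add 1)) ?_
    -- The exceptional null set depends on `ε`; countably many levels `1/(m+1)` give a common one.
    have : ∀ᵐ ω ∂P, ∀ m : ℕ, ∀ᶠ n in atTop, |f n ω| ≤ (1 / ((m : ℝ) + 1)) * |g n ω| :=
      ae_all_iff.2 fun m => h _ Nat.one_div_pos_of_nat
    filter_upwards [this] with ω hω
    rw [Metric.tendsto_atTop']
    intro ε hε
    obtain ⟨m, hm⟩ := exists_nat_one_div_lt hε
    obtain ⟨N, hN⟩ := eventually_atTop.1 (hω m)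
    refine ⟨N, fun n hn => ?_⟩
    have h₁ := hN n hn.le
    have h₂ : 0 < 1 + |g n ω| := by positivity
    rw [dist_zero_right, Real.norm_eq_abs, abs_div, abs_of_pos h₂, div_lt_iff₀ h₂]
    nlinarith [abs_nonneg (g n ω)]
  have hg' : BoundedInProb P fun n ω => 1 + |g n ω| := by
    refine BoundedInProb.add (f := fun _ _ => (1 : ℝ))
      (boundedInProb_of_abs_le (.of_forall fun _ _ => le_rfl)) ?_
    simpa only [BoundedInProb, abs_abs] using hb
  refine (hg'.mul_negligible hr).congr (.of_forall fun n => ae_of_all _ fun ω => ?_)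
  have h₂ : 0 < 1 + |g n ω| := by positivity
  exact mul_div_cancel₀ _ h₂.ne'

theorem BoundedInProb.of_variance_le [IsProbabilityMeasure P] {f : ℕ → Ω → ℝ} {C : ℝ}
    (hf : ∀ n, MemLp (f n) 2 P) (h0 : ∀ n, P[f n] = 0) (hv : ∀ n, Var[f n; P] ≤ C) :
    BoundedInProb P f := by
  intro ε hε
  have hC : 0 ≤ C := (variance_nonneg _ _).trans (hv 0)
  -- Chebyshev's inequality at this squared level; the `+ 1` keeps it positive when `C = 0`.
  have hpos : 0 < (C + 1) / ε := by positivity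
  refine ⟨√((C + 1) / ε), Real.sqrt_pos.2 hpos, .of_forall fun n => ?_⟩
  have := meas_ge_le_variance_div_sq (hf n) (Real.sqrt_pos.2 hpos)
  rw [h0 n, Real.sq_sqrt hpos.le] at this
  simp only [sub_zero] at this
  refine ENNReal.toReal_le_of_le_ofReal hε.le (this.trans (ENNReal.ofReal_le_ofReal ?_))
  rw [div_le_iff₀ hpos, mul_div_cancel₀ _ hε.ne']
  linarith [hv n]

end Stochastic

/-! ### Empirical process of an i.i.d. sample -/

section Sample

variable {Ω : Type*} [MeasurableSpace Ω] {P : Measure Ω} {ν : Measure ℝ} {X : ℕ → Ω → ℝ}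

/-- The empirical process `√n (mean of h - expectation of h)`. -/
noncomputable def empProc (ν : Measure ℝ) (h : ℝ → ℝ) (X : ℕ → Ω → ℝ) (n : ℕ) (ω : Ω) : ℝ :=
  (√n)⁻¹ * (∑ i ∈ Finset.range n, h (X i ω) - n * ∫ x, h x ∂ν)

theorem aemeasurable_empProc (hX : ∀ i, HasLaw (X i) ν P) {h : ℝ → ℝ} (hh : Measurable h)
    (n : ℕ) : AEMeasurable (empProc ν h X n) P := by
  have := fun i => (hX i).aemeasurable
  unfold empProc
  fun_prop

theorem identDistrib_comp (hX : ∀ i, HasLaw (X i) ν P) {h : ℝ → ℝ} (hh : Measurable h) (i : ℕ) :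
    IdentDistrib (fun ω => h (X i ω)) (fun ω => h (X 0 ω)) P P :=
  IdentDistrib.comp ⟨(hX i).aemeasurable, (hX 0).aemeasurable,
    (hX i).map_eq.trans (hX 0).map_eq.symm⟩ hh

theorem memLp_comp_of_hasLaw {p : ENNReal} (hX : HasLaw (X 0) ν P) {h : ℝ → ℝ}
    (hh : MemLp h p ν) : MemLp (fun ω => h (X 0 ω)) p P := by
  rw [← hX.map_eq] at hh
  exact hh.comp_of_map hX.aemeasurable

theorem integral_comp_of_hasLaw {i : ℕ} (hX : HasLaw (X i) ν P) {h : ℝ → ℝ} (hh : Measurable h) :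
    ∫ ω, h (X i ω) ∂P = ∫ x, h x ∂ν :=
  hX.integral_comp (f := h) hh.aestronglyMeasurable

theorem strong_law_comp [IsProbabilityMeasure P] (hX : ∀ i, HasLaw (X i) ν P) (hi : iIndepFun X P) {h : ℝ → ℝ}
    (hh : Measurable h) (hint : Integrable h ν) :
    ∀ᵐ ω ∂P, Tendsto (fun n : ℕ => (∑ i ∈ Finset.range n, h (X i ω)) / n) atTop
      (𝓝 (∫ x, h x ∂ν)) := by
  have hc := hi.comp (fun _ => h) fun _ => hh
  have := strong_law_ae_real (μ := P) (fun i ω => h (X i ω))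
    (memLp_one_iff_integrable.1 (memLp_comp_of_hasLaw (hX 0) (memLp_one_iff_integrable.2 hint)))
    (fun i j hij => hc.indepFun hij) (identDistrib_comp hX hh)
  rwa [integral_comp_of_hasLaw (hX 0) hh] at this

theorem tendstoInDistribution_empProc [IsProbabilityMeasure P] (hX : ∀ i, HasLaw (X i) ν P) (hi : iIndepFun X P)
    {h : ℝ → ℝ} (hh : Measurable h) (hL : MemLp h 2 ν) :
    TendstoInDistribution (empProc ν h X) atTop (id : ℝ → ℝ) (fun _ => P)
      (gaussianReal 0 Var[h; ν].toNNReal) := by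
  have hv : Var[fun ω => h (X 0 ω); P] = Var[h; ν] := by
    rw [← (hX 0).map_eq, variance_map (by rw [(hX 0).map_eq]; exact hh.aemeasurable)
      (hX 0).aemeasurable]
    rfl
  have := tendstoInDistribution_inv_sqrt_mul_sum_sub (P := P)
    (P' := gaussianReal 0 Var[h; ν].toNNReal)
    (X := fun i ω => h (X i ω)) (Y := id) (by rw [hv]; exact HasLaw.id)
    (memLp_comp_of_hasLaw (hX 0) hL) (hi.comp (fun _ => h) fun _ => hh)
    (identDistrib_comp hX hh)
  rwa [integral_comp_of_hasLaw (hX 0) hh] at this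

/-- By independence the variance is that of `h (X 0)` for every `n ≥ 1`, so Chebyshev's inequality
is uniform in `n`. -/
theorem boundedInProb_empProc [IsProbabilityMeasure P] (hX : ∀ i, HasLaw (X i) ν P) (hi : iIndepFun X P)
    {h : ℝ → ℝ} (hh : Measurable h) (hL : MemLp h 2 ν) : BoundedInProb P (empProc ν h X) := by
  have hid := identDistrib_comp hX hh
  have hL0 := memLp_comp_of_hasLaw (hX 0) hL
  have hLi : ∀ i, MemLp (fun ω => h (X i ω)) 2 P := fun i => (hid i).memLp_iff.2 hL0
  have hc := hi.comp (fun _ => h) fun _ => hh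
  have hmean := fun i => integral_comp_of_hasLaw (hX i) hh
  have hS : ∀ n, MemLp (fun ω => ∑ i ∈ Finset.range n, h (X i ω)) 2 P := fun n =>
    memLp_finsetSum _ fun i _ => hLi i
  refine BoundedInProb.of_variance_le (C := Var[fun ω => h (X 0 ω); P]) (fun n => ?_)
    (fun n => ?_) fun n => ?_
  · exact ((hS n).sub (memLp_const _)).const_mul _
  · unfold empProc
    rw [integral_const_mul, integral_sub ((hS n).integrable (by norm_num)) (integrable_const _),
      integral_finsetSum _ fun i _ => (hLi i).integrable (by norm_num)]
    simp [hmean]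
  · unfold empProc
    rw [variance_const_mul, variance_sub_const (hS n).aestronglyMeasurable]
    have hsum : Var[fun ω => ∑ i ∈ Finset.range n, h (X i ω); P] =
        n * Var[fun ω => h (X 0 ω); P] := by
      have := IndepFun.variance_sum (μ := P) (X := fun i ω => h (X i ω)) (s := Finset.range n)
        (fun i _ => hLi i) (fun i _ j _ hij => hc.indepFun hij)
      rw [Finset.sum_congr rfl fun i _ => (hid i).variance_eq] at this
      rw [← Finset.sum_fn, this]
      simp
    rw [hsum, inv_pow, Real.sq_sqrt (Nat.cast_nonneg n), ← mul_assoc]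
    rcases eq_or_ne n 0 with rfl | hn
    · simp [variance_nonneg]
    · rw [inv_mul_cancel₀ (by exact_mod_cast hn), one_mul]

end Sample

/-! ### The Lévy law, its reciprocal and its scaling -/

theorem levyPDF_nonneg (c x : ℝ) : 0 ≤ levyPDF c x := by
  unfold levyPDF
  split_ifs with h
  · have := Real.rpow_nonneg h (-(3 / 2) : ℝ)
    positivity
  · exact le_rfl

theorem levyPDF_of_nonpos (c : ℝ) {x : ℝ} (hx : x ≤ 0) : levyPDF c x = 0 := by
  unfold levyPDF
  split_ifs with h
  -- At the origin the convention `0 ^ (-3/2) = 0` makes the density vanish.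
  · rw [le_antisymm hx h, Real.zero_rpow (by norm_num)]
    simp
  · rfl

theorem levyPDF_pos {c x : ℝ} (hc : 0 < c) (hx : 0 < x) : 0 < levyPDF c x := by
  rw [levyPDF, if_pos hx.le]
  positivity

theorem measurable_levyPDF (c : ℝ) : Measurable (levyPDF c) := by
  unfold levyPDF
  exact Measurable.ite measurableSet_Ici (by fun_prop) measurable_const

/-- The density of the reciprocal of a standard Lévy variable, on the positive half-line. -/
noncomputable def recipPDF (y : ℝ) : ℝ :=
  (√(2 * Real.pi))⁻¹ * (y ^ (1 / 2 - 1 : ℝ) * Real.exp (-(1 / 2 * y)))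

/-- The factor `x ^ (-1 - 1)` is the Jacobian of `y = x ^ (-1)`, in the shape required by the power
substitution on the half-line. -/
theorem levyPDF_one_eq_recipPDF {x : ℝ} (hx : 0 < x) :
    levyPDF 1 x = x ^ (-1 - 1 : ℝ) * recipPDF (x ^ (-1 : ℝ)) := by
  rw [levyPDF, if_pos hx.le, recipPDF, ← Real.rpow_mul hx.le, one_div (2 * Real.pi), Real.sqrt_inv,
    mul_left_comm (x ^ (-1 - 1 : ℝ)), ← mul_assoc (x ^ (-1 - 1 : ℝ)), ← Real.rpow_add hx,
    Real.rpow_neg_one, mul_assoc]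
  congr 3
  · norm_num
  · field_simp

theorem integral_levyMeasure_eq (c : ℝ) (h : ℝ → ℝ) :
    ∫ x, h x ∂(levyMeasure c) = ∫ x in Set.Ioi 0, levyPDF c x * h x := by
  rw [levyMeasure, integral_withDensity_eq_integral_toReal_smul
    (measurable_levyPDF c).ennreal_ofReal (by simp)]
  simp only [ENNReal.toReal_ofReal (levyPDF_nonneg _ _), smul_eq_mul]
  rw [setIntegral_eq_integral_of_forall_compl_eq_zero]
  intro x hx
  rw [levyPDF_of_nonpos c (by simpa using hx), zero_mul]

theorem integrable_levyMeasure_iff (c : ℝ) (h : ℝ → ℝ) :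
    Integrable h (levyMeasure c) ↔
      IntegrableOn (fun x => levyPDF c x * h x) (Set.Ioi 0) := by
  rw [levyMeasure, integrable_withDensity_iff_integrable_smul'
    (measurable_levyPDF c).ennreal_ofReal (by simp)]
  simp only [ENNReal.toReal_ofReal (levyPDF_nonneg _ _), smul_eq_mul]
  rw [integrableOn_iff_integrable_of_support_subset]
  intro x hx
  by_contra h'
  exact hx (by simp [levyPDF_of_nonpos c (not_lt.1 h')])

/-- The reciprocal of a standard Lévy variable is Gamma(1/2, 1/2), so moments of `1/W` reduce to
Gamma integrals. -/
theorem integral_levyMeasure_one (h : ℝ → ℝ) :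
    ∫ x, h x ∂(levyMeasure 1) = ∫ y in Set.Ioi 0, recipPDF y * h y⁻¹ := by
  rw [integral_levyMeasure_eq,
    ← integral_comp_rpow_Ioi (fun y => recipPDF y * h y⁻¹) (show (-1 : ℝ) ≠ 0 by norm_num)]
  refine setIntegral_congr_fun measurableSet_Ioi fun x hx => ?_
  simp only [levyPDF_one_eq_recipPDF hx, abs_neg, abs_one, one_mul, smul_eq_mul]
  rw [Real.rpow_neg_one, inv_inv, mul_assoc]

theorem integrable_levyMeasure_one (h : ℝ → ℝ) :
    Integrable h (levyMeasure 1) ↔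
      IntegrableOn (fun y => recipPDF y * h y⁻¹) (Set.Ioi 0) := by
  rw [integrable_levyMeasure_iff, ← integrableOn_Ioi_comp_rpow_iff'
    (fun y => recipPDF y * h y⁻¹) (show (-1 : ℝ) ≠ 0 by norm_num)]
  refine integrableOn_congr_fun (fun x hx => ?_) measurableSet_Ioi
  simp only [levyPDF_one_eq_recipPDF hx, smul_eq_mul]
  rw [Real.rpow_neg_one, inv_inv, mul_assoc]

theorem recipPDF_mul_rpow {y : ℝ} (hy : 0 < y) (s : ℝ) :
    recipPDF y * y ^ s =
      (√(2 * Real.pi))⁻¹ * (y ^ ((s + 1 / 2) - 1 : ℝ) * Real.exp (-(1 / 2 * y))) := by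
  rw [recipPDF, mul_assoc, mul_right_comm, ← Real.rpow_add hy]
  congr 3
  ring

theorem integral_recipPDF_mul_rpow {s : ℝ} (hs : -(1 / 2) < s) :
    ∫ y in Set.Ioi 0, recipPDF y * y ^ s =
      (√(2 * Real.pi))⁻¹ * (2 ^ (s + 1 / 2) * Real.Gamma (s + 1 / 2)) := by
  rw [setIntegral_congr_fun measurableSet_Ioi fun y hy => recipPDF_mul_rpow hy s,
    integral_const_mul, Real.integral_rpow_mul_exp_neg_mul_Ioi (by linarith) (by norm_num)]
  norm_num

theorem integrableOn_recipPDF_mul_rpow {s : ℝ} (hs : -(1 / 2) < s) :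
    IntegrableOn (fun y => recipPDF y * y ^ s) (Set.Ioi 0) := by
  -- A non-integrable function has integral `0` by convention, so a nonzero value proves
  -- integrability.
  refine .of_integral_ne_zero ?_
  rw [integral_recipPDF_mul_rpow hs]
  have := Real.Gamma_pos_of_pos (show 0 < s + 1 / 2 by linarith)
  positivity

theorem integral_recipPDF : ∫ y in Set.Ioi 0, recipPDF y = 1 := by
  have := integral_recipPDF_mul_rpow (s := 0) (by norm_num)
  simp only [Real.rpow_zero, mul_one, zero_add, Real.Gamma_one_half_eq] at this
  rw [this, ← Real.sqrt_eq_rpow, ← Real.sqrt_mul (by norm_num)]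
  exact inv_mul_cancel₀ (by positivity)

theorem integrableOn_recipPDF : IntegrableOn recipPDF (Set.Ioi 0) := by
  simpa using integrableOn_recipPDF_mul_rpow (s := 0) (by norm_num)

instance isProbabilityMeasure_levyMeasure_one : IsProbabilityMeasure (levyMeasure 1) := by
  have hint : Integrable (levyPDF 1) := by
    have := (integrable_levyMeasure_iff 1 fun _ => 1).1
      ((integrable_levyMeasure_one fun _ => 1).2 (by simpa using integrableOn_recipPDF))
    simp only [mul_one] at this
    rwa [integrableOn_iff_integrable_of_support_subset] at this
    intro x hx
    by_contra h'
    exact hx (levyPDF_of_nonpos 1 (not_lt.1 h'))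
  refine ⟨?_⟩
  rw [levyMeasure, withDensity_apply _ .univ, Measure.restrict_univ,
    ← ofReal_integral_eq_lintegral_ofReal hint (ae_of_all _ (levyPDF_nonneg 1))]
  have h₁ := integral_levyMeasure_eq 1 fun _ => 1
  rw [integral_levyMeasure_one] at h₁
  simp only [mul_one, integral_recipPDF] at h₁
  rw [← setIntegral_eq_integral_of_forall_compl_eq_zero (s := Set.Ioi 0) fun x hx =>
    levyPDF_of_nonpos 1 (by simpa using hx), ← h₁, ENNReal.ofReal_one]

theorem levyMeasure_Iic_zero (c : ℝ) : levyMeasure c (Set.Iic 0) = 0 := by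
  rw [levyMeasure, withDensity_apply _ measurableSet_Iic]
  refine (setLIntegral_congr_fun measurableSet_Iic fun x hx => ?_).trans lintegral_zero
  simp [levyPDF_of_nonpos c hx]

theorem ae_pos_levyMeasure (c : ℝ) : ∀ᵐ x ∂(levyMeasure c), 0 < x := by
  rw [ae_iff]
  convert levyMeasure_Iic_zero c using 2
  ext x
  simp

/-- The densities satisfy `f(x; c) = c⁻¹ f(c⁻¹ x; 1)`, and the factor `c⁻¹` is the Jacobian. -/
theorem map_mul_levyMeasure {c : ℝ} (hc : 0 < c) :
    (levyMeasure c).map (fun x => c⁻¹ * x) = levyMeasure 1 := by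
  have hc' : c⁻¹ ≠ 0 := (inv_pos.2 hc).ne'
  have hpdf : ∀ x, levyPDF c x = c⁻¹ * levyPDF 1 (c⁻¹ * x) := by
    intro x
    rcases le_or_gt x 0 with hx | hx
    · rw [levyPDF_of_nonpos c hx,
        levyPDF_of_nonpos 1 (mul_nonpos_of_nonneg_of_nonpos (inv_pos.2 hc).le hx), mul_zero]
    · rw [levyPDF, levyPDF, if_pos hx.le, if_pos (by positivity),
        Real.mul_rpow (by positivity) hx.le, Real.sqrt_div hc.le, Real.sqrt_div zero_le_one,
        Real.inv_rpow hc.le, ← Real.rpow_neg hc.le, Real.sqrt_eq_rpow c, Real.sqrt_one]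
      have h₁ : c ^ (1 / 2 : ℝ) = c⁻¹ * c ^ (-(-(3 / 2)) : ℝ) := by
        rw [← Real.rpow_neg_one, ← Real.rpow_add hc]
        norm_num
      have h₂ : c / (2 * x) = 1 / (2 * (c⁻¹ * x)) := by field_simp
      rw [h₁, h₂]
      ring
  ext s hs
  have hm : Measurable fun x : ℝ => c⁻¹ * x := measurable_const_mul _
  rw [Measure.map_apply hm hs, levyMeasure, levyMeasure, withDensity_apply _ (hm hs),
    withDensity_apply _ hs]
  have hm' : Measurable fun x => ENNReal.ofReal (levyPDF 1 (c⁻¹ * x)) :=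
    (measurable_levyPDF 1).ennreal_ofReal.comp hm
  nth_rw 2 [← Real.smul_map_volume_mul_left hc']
  rw [Measure.restrict_smul, lintegral_smul_measure, setLIntegral_map hs
    (measurable_levyPDF 1).ennreal_ofReal hm, smul_eq_mul, abs_of_pos (inv_pos.2 hc),
    ← lintegral_const_mul _ hm']
  refine lintegral_congr fun x => ?_
  rw [hpdf, ENNReal.ofReal_mul (inv_pos.2 hc).le]

/-! ### Moments of `1/W` and `ln (1/W)` -/

/-- The fourth power has exponent `4s`, integrable against the Gamma density when `4s > -1/2`.
Fourth moments are what puts products of two such variables in L². -/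
theorem memLp_inv_rpow {s : ℝ} (hs : -(1 / 8) < s) :
    MemLp (fun x : ℝ => (x⁻¹) ^ s) 4 (levyMeasure 1) := by
  have hm : Measurable fun x : ℝ => (x⁻¹) ^ s := by fun_prop
  rw [← integrable_norm_rpow_iff hm.aestronglyMeasurable (by norm_num) (by norm_num),
    integrable_levyMeasure_one]
  refine (integrableOn_recipPDF_mul_rpow (s := s * 4) (by linarith)).congr_fun (fun y hy => ?_)
    measurableSet_Ioi
  have hy' : 0 < y := hy
  simp only [inv_inv, Real.norm_eq_abs]
  rw [abs_of_nonneg (by positivity), Real.rpow_mul hy'.le]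
  norm_num

theorem memLp_one_div : MemLp (fun x : ℝ => 1 / x) 4 (levyMeasure 1) := by
  simpa using memLp_inv_rpow (s := 1) (by norm_num)

/-- The logarithm is dominated by `16 (y ^ (1/16) + y ^ (-1/16))`, and `-1/16` is above the
threshold `-1/8`. -/
theorem memLp_log_one_div : MemLp (fun x : ℝ => Real.log (1 / x)) 4 (levyMeasure 1) := by
  have h := ((memLp_inv_rpow (s := 1 / 16) (by norm_num)).add
    (memLp_inv_rpow (s := -(1 / 16)) (by norm_num))).const_mul 16
  have hm : Measurable fun x : ℝ => Real.log (1 / x) := by fun_prop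
  refine h.mono hm.aestronglyMeasurable ?_
  filter_upwards [ae_pos_levyMeasure 1] with x hx
  have hx' : 0 < x⁻¹ := inv_pos.2 hx
  have h₁ := Real.log_le_rpow_div hx'.le (show (0 : ℝ) < 1 / 16 by norm_num)
  have h₂ := Real.log_le_rpow_div hx.le (show (0 : ℝ) < 1 / 16 by norm_num)
  have h₃ : x ^ (1 / 16 : ℝ) = x⁻¹ ^ (-(1 / 16) : ℝ) := by
    rw [Real.inv_rpow hx.le, Real.rpow_neg hx.le, inv_inv]
  have h₄ := Real.rpow_nonneg hx'.le (1 / 16)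
  have h₅ := Real.rpow_nonneg hx'.le (-(1 / 16))
  rw [h₃] at h₂
  simp only [Pi.add_apply, Real.norm_eq_abs, one_div x]
  rw [abs_of_nonneg (by positivity : (0:ℝ) ≤ 16 * _), abs_le]
  rw [Real.log_inv] at h₁ ⊢
  constructor <;> linarith

theorem integral_one_div : ∫ x, 1 / x ∂(levyMeasure 1) = 1 := by
  rw [integral_levyMeasure_one]
  have := integral_recipPDF_mul_rpow (s := 1) (by norm_num)
  simp only [Real.rpow_one] at this
  simp only [one_div, inv_inv, this]
  have h : (1 : ℝ) + 2⁻¹ = 1 / 2 + 1 := by norm_num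
  rw [h, Real.Gamma_add_one (by norm_num), Real.Gamma_one_half_eq,
    Real.rpow_add (by norm_num), Real.rpow_one, ← Real.sqrt_eq_rpow, Real.sqrt_mul (by norm_num)]
  field_simp

/-- Stein's identity `E[(Y - 1) g(Y)] = 2 E[Y g'(Y)]` for the Gamma(1/2, 1/2) law, with `g = ln`. -/
theorem integral_mul_log :
    ∫ x, (1 / x - 1) * Real.log (1 / x) ∂(levyMeasure 1) = 2 := by
  have hint : Integrable (fun x : ℝ => (1 / x - 1) * Real.log (1 / x)) (levyMeasure 1) := by
    have : MemLp (fun x : ℝ => (1 / x - 1) * Real.log (1 / x)) 2 (levyMeasure 1) :=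
      memLp_log_one_div.mul' (memLp_one_div.sub (memLp_const 1))
        (hpqr := ⟨by
          rw [show (4 : ENNReal) = 2 * 2 by norm_num,
            ENNReal.mul_inv (by simp) (by simp), ← mul_add, ENNReal.inv_two_add_inv_two, mul_one]⟩)
    exact this.integrable (by norm_num)
  have hint' := (integrable_levyMeasure_one _).1 hint
  rw [integral_levyMeasure_one]
  simp only [one_div, inv_inv] at hint' ⊢
  set C := (√(2 * Real.pi))⁻¹ with hC
  -- `G y = -2 y ρ(y) ln y` with `ρ` the Gamma density; it vanishes at both ends of the half-line.
  let G : ℝ → ℝ := fun y => -2 * C * (Real.log y * y ^ (1 / 2 : ℝ) * Real.exp (-(1 / 2) * y))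
  have hderiv : ∀ y ∈ Set.Ioi (0 : ℝ),
      HasDerivAt G (recipPDF y * ((y - 1) * Real.log y) - 2 * recipPDF y) y := by
    intro y hy
    have hy' : 0 < y := hy
    have h₁ := (((Real.hasDerivAt_log hy'.ne').mul
      (Real.hasDerivAt_rpow_const (p := 1 / 2) (Or.inl hy'.ne'))).mul
        ((hasDerivAt_id y).const_mul (-(1 / 2) : ℝ)).exp).const_mul (-2 * C)
    refine h₁.congr_deriv ?_
    have h₂ : y ^ (1 / 2 : ℝ) = y ^ (1 / 2 - 1 : ℝ) * y := by
      rw [← Real.rpow_add_one hy'.ne']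
      norm_num
    simp only [recipPDF, id, ← hC, neg_mul, Pi.mul_apply]
    rw [h₂]
    field_simp
    ring
  have hcont : ContinuousWithinAt G (Set.Ici 0) 0 := by
    rw [← Set.Ioi_insert, continuousWithinAt_insert_self, ContinuousWithinAt]
    have h₁ := tendsto_log_mul_rpow_nhdsGT_zero (r := 1 / 2) (by norm_num)
    have h₂ : Tendsto (fun y : ℝ => Real.exp (-(1 / 2) * y)) (𝓝[>] 0) (𝓝 (Real.exp 0)) := by
      have : Continuous fun y : ℝ => Real.exp (-(1 / 2) * y) := by fun_prop
      simpa using (this.tendsto 0).mono_left nhdsWithin_le_nhds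
    simpa [G] using (h₁.mul h₂).const_mul (-2 * C)
  have htop : Tendsto G atTop (𝓝 0) := by
    have h₁ := tendsto_rpow_mul_exp_neg_mul_atTop_nhds_zero (3 / 2) (1 / 2) (by norm_num)
    have h₂ : Tendsto (fun y : ℝ => Real.log y * y ^ (1 / 2 : ℝ) * Real.exp (-(1 / 2) * y))
        atTop (𝓝 0) := by
      refine squeeze_zero' ?_ ?_ h₁
      · filter_upwards [eventually_ge_atTop 1] with y hy
        have := Real.log_nonneg hy
        have := Real.rpow_nonneg (zero_le_one.trans hy) (1 / 2)
        positivity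
      · filter_upwards [eventually_ge_atTop 1] with y hy
        have hy' : 0 < y := one_pos.trans_le hy
        have h₃ : y ^ (3 / 2 : ℝ) = y * y ^ (1 / 2 : ℝ) := by
          rw [← Real.rpow_one_add' hy'.le (by norm_num)]
          norm_num
        rw [h₃]
        gcongr
        linarith [Real.log_le_sub_one_of_pos hy']
    simpa [G] using h₂.const_mul (-2 * C)
  have := integral_Ioi_of_hasDerivAt_of_tendsto hcont hderiv
    (hint'.sub (integrableOn_recipPDF.const_mul 2)) htop
  rw [integral_sub hint' (integrableOn_recipPDF.const_mul 2), integral_const_mul,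
    integral_recipPDF] at this
  simp [G] at this
  linarith

/-! ### Distribution function and quantiles -/

instance nullSingletonClass_levyMeasure (c : ℝ) : NullSingletonClass (levyMeasure c) :=
  nullSingletonClass_withDensity _

theorem continuous_cdf (μ : Measure ℝ) [IsProbabilityMeasure μ] [NullSingletonClass μ] :
    Continuous (cdf μ) := by
  refine continuous_iff_continuousAt.2 fun x => ?_
  rw [(monotone_cdf μ).continuousAt_iff_leftLim_eq_rightLim, StieltjesFunction.rightLim_eq]
  have h := StieltjesFunction.measure_singleton (cdf μ) x
  rw [measure_cdf, measure_singleton] at h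
  exact le_antisymm ((monotone_cdf μ).leftLim_le le_rfl)
    (sub_nonpos.1 (ENNReal.ofReal_eq_zero.1 h.symm))

theorem cdf_levyMeasure_zero : cdf (levyMeasure 1) 0 = 0 := by
  rw [cdf_eq_real, measureReal_def, levyMeasure_Iic_zero, ENNReal.toReal_zero]

theorem levyMeasure_Ioc_pos {x y : ℝ} (hx : 0 ≤ x) (hxy : x < y) :
    0 < (levyMeasure 1).real (Set.Ioc x y) := by
  rw [measureReal_def, ENNReal.toReal_pos_iff]
  refine ⟨pos_iff_ne_zero.2 fun h => ?_, measure_lt_top _ _⟩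
  rw [levyMeasure, withDensity_apply _ measurableSet_Ioc,
    lintegral_eq_zero_iff (measurable_levyPDF 1).ennreal_ofReal] at h
  have hpos : ∀ᵐ t ∂(volume.restrict (Set.Ioc x y)), ENNReal.ofReal (levyPDF 1 t) ≠ 0 := by
    filter_upwards [ae_restrict_mem measurableSet_Ioc] with t ht
    simpa using levyPDF_pos one_pos (hx.trans_lt ht.1)
  have hfalse : ∀ᵐ t ∂(volume.restrict (Set.Ioc x y)), False := by
    filter_upwards [h, hpos] with t h₁ h₂ using h₂ h₁
  rw [ae_iff] at hfalse
  simp at hfalse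
  linarith

theorem cdf_levyMeasure_sub {x y : ℝ} (hxy : x ≤ y) :
    cdf (levyMeasure 1) y - cdf (levyMeasure 1) x = (levyMeasure 1).real (Set.Ioc x y) := by
  rw [cdf_eq_real, cdf_eq_real, ← Set.Iic_union_Ioc_eq_Iic hxy,
    measureReal_union (Set.Iic_disjoint_Ioc le_rfl) measurableSet_Ioc]
  ring

theorem cdf_levyMeasure_lt {x y : ℝ} (hy : 0 < y) (hxy : x < y) :
    cdf (levyMeasure 1) x < cdf (levyMeasure 1) y := by
  have h₁ : cdf (levyMeasure 1) x ≤ cdf (levyMeasure 1) (max x 0) :=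
    monotone_cdf _ (le_max_left _ _)
  have h₂ := cdf_levyMeasure_sub (max_lt hxy hy).le
  have h₃ := levyMeasure_Ioc_pos (le_max_right x 0) (max_lt hxy hy)
  linarith

theorem exists_quantile_eq {p : ℝ} (hp : 0 < p) (hp' : p < 1) :
    ∃ q : ℝ, 0 < q ∧ cdf (levyMeasure 1) q = p ∧ quantile (levyMeasure 1) p = q := by
  obtain ⟨r, hr⟩ := (Tendsto.eventually_const_lt hp' (tendsto_cdf_atTop (levyMeasure 1))).exists
  have hr0 : 0 ≤ r := by
    by_contra! h
    have := monotone_cdf (levyMeasure 1) h.le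
    rw [cdf_levyMeasure_zero] at this
    linarith
  obtain ⟨q, hq, hq'⟩ := intermediate_value_Icc hr0 (continuous_cdf (levyMeasure 1)).continuousOn
    (show p ∈ Set.Icc _ _ by rw [cdf_levyMeasure_zero]; exact ⟨hp.le, hr.le⟩)
  have hq0 : 0 < q := by
    refine lt_of_le_of_ne hq.1 ?_
    rintro rfl
    rw [cdf_levyMeasure_zero] at hq'
    exact hp.ne hq'
  refine ⟨q, hq0, hq', IsGLB.sInf_eq (IsLeast.isGLB ⟨⟨q, hq'.ge, rfl⟩, ?_⟩)⟩
  rintro _ ⟨x, hx, rfl⟩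
  refine EReal.coe_le_coe_iff.2 (not_lt.1 fun h => ?_)
  have := cdf_levyMeasure_lt hq0 h
  rw [hq'] at this
  exact this.not_ge hx

theorem quantile_zero (μ : Measure ℝ) : quantile μ 0 = ⊥ := by
  refine (EReal.eq_bot_iff_forall_lt _).2 fun y => ?_
  have h : quantile μ 0 ≤ ((y - 1 : ℝ) : EReal) :=
    sInf_le ⟨y - 1, cdf_nonneg μ _, rfl⟩
  exact h.trans_lt (EReal.coe_lt_coe_iff.2 (by linarith))

/-- When `a = 0` the lower quantile is `-∞`; since the law lives on the positive half-line, `α = 0`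
serves instead. The half-open interval differs by a null set and has mass `F(β) - F(α)`. -/
theorem quantileSet_ae_eq {a b : ℝ} (ha : 0 ≤ a) (hab : a < b) (hb : b < 1) :
    ∃ α β : ℝ, 0 ≤ α ∧ α < β ∧ cdf (levyMeasure 1) α = a ∧ cdf (levyMeasure 1) β = b ∧
      (α = 0 → a = 0) ∧
      quantileSet (levyMeasure 1) a b =ᵐ[levyMeasure 1] Set.Ioc α β := by
  obtain ⟨β, hβ, hβ₁, hβ₂⟩ := exists_quantile_eq (ha.trans_lt hab) hb
  rcases ha.eq_or_lt with rfl | ha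
  · refine ⟨0, β, le_rfl, hβ, cdf_levyMeasure_zero, hβ₁, fun _ => rfl,
      eventuallyEq_set.2 ?_⟩
    filter_upwards [ae_pos_levyMeasure 1] with x hx
    simp [quantileSet, quantile_zero, hβ₂, hx]
  · obtain ⟨α, hα, hα₁, hα₂⟩ := exists_quantile_eq ha (hab.trans hb)
    refine ⟨α, β, hα.le, ?_, hα₁, hβ₁, fun h => absurd h hα.ne', ?_⟩
    · by_contra! h
      have := monotone_cdf (levyMeasure 1) h
      linarith
    · have : quantileSet (levyMeasure 1) a b = Set.Icc α β := by
        ext x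
        simp [quantileSet, hα₂, hβ₂]
      rw [this]
      exact Ioc_ae_eq_Icc.symm

/-! ### Quantile conditional mean through shortfalls -/

theorem qcm_eq_setIntegral (μ : Measure ℝ) (a b : ℝ) {s : Set ℝ}
    (hs : quantileSet μ a b =ᵐ[μ] s) : qcm μ a b = (μ.real s)⁻¹ * ∫ x in s, x ∂μ := by
  rw [qcm, ProbabilityTheory.cond, integral_smul_measure, Measure.restrict_congr_set hs,
    measure_congr hs, ENNReal.toReal_inv, smul_eq_mul]
  rfl

theorem integrableOn_id_Iic_levyMeasure (q : ℝ) :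
    IntegrableOn (fun x : ℝ => x) (Set.Iic q) (levyMeasure 1) := by
  refine Measure.integrableOn_of_bounded (M := q) (measure_ne_top _ _)
    measurable_id.aestronglyMeasurable ?_
  filter_upwards [ae_restrict_mem measurableSet_Iic,
    ae_restrict_of_ae (ae_pos_levyMeasure 1)] with x hx hx'
  rwa [Real.norm_of_nonneg hx'.le]

/-- The shortfall `(q - x)⁺` of `x` below the level `q`. -/
noncomputable def shortfall (q x : ℝ) : ℝ := max (q - x) 0

theorem measurable_shortfall (q : ℝ) : Measurable (shortfall q) := by
  unfold shortfall
  fun_prop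

/-- Shortfalls are bounded on the positive half-line, so they have all moments although the Lévy law
has infinite mean. -/
theorem memLp_shortfall (q : ℝ) (p : ENNReal) : MemLp (shortfall q) p (levyMeasure 1) := by
  refine MemLp.of_bound (measurable_shortfall q).aestronglyMeasurable |q| ?_
  filter_upwards [ae_pos_levyMeasure 1] with x hx
  rw [shortfall, Real.norm_of_nonneg (le_max_right _ _)]
  exact max_le (by linarith [le_abs_self q]) (abs_nonneg q)

theorem integral_shortfall (q : ℝ) :
    ∫ x, shortfall q x ∂(levyMeasure 1) =
      q * cdf (levyMeasure 1) q - ∫ x in Set.Iic q, x ∂(levyMeasure 1) := by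
  have h : shortfall q = (Set.Iic q).indicator fun x => q - x := by
    ext x
    by_cases hx : x ≤ q
    · rw [Set.indicator_of_mem (show x ∈ Set.Iic q from hx), shortfall, max_eq_left (by linarith)]
    · rw [Set.indicator_of_notMem (show x ∉ Set.Iic q from hx), shortfall,
        max_eq_right (by linarith [not_le.1 hx])]
  rw [h, integral_indicator measurableSet_Iic,
    integral_sub (integrable_const q) (integrableOn_id_Iic_levyMeasure q), setIntegral_const,
    cdf_eq_real, smul_eq_mul, mul_comm]

/-- The quantile conditional mean of the standard Lévy law in terms of shortfalls at the
quantiles. -/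
theorem exists_quantiles_qcm {a b : ℝ} (ha : 0 ≤ a) (hab : a < b) (hb : b < 1) :
    ∃ α β : ℝ, 0 ≤ α ∧ α < β ∧ cdf (levyMeasure 1) α = a ∧ cdf (levyMeasure 1) β = b ∧
      (α = 0 → a = 0) ∧ 0 < qcm (levyMeasure 1) a b ∧
      (b - a) * qcm (levyMeasure 1) a b = b * β - a * α -
        (∫ x, shortfall β x ∂(levyMeasure 1) - ∫ x, shortfall α x ∂(levyMeasure 1)) := by
  obtain ⟨α, β, hα, hαβ, h₁, h₂, h₃, hs⟩ := quantileSet_ae_eq ha hab hb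
  have hreal : (levyMeasure 1).real (Set.Ioc α β) = b - a := by
    rw [← cdf_levyMeasure_sub hαβ.le, h₁, h₂]
  have hq := qcm_eq_setIntegral (levyMeasure 1) a b hs
  rw [hreal] at hq
  have hIoc : IntegrableOn (fun x : ℝ => x) (Set.Ioc α β) (levyMeasure 1) :=
    (integrableOn_id_Iic_levyMeasure β).mono_set Set.Ioc_subset_Iic_self
  refine ⟨α, β, hα, hαβ, h₁, h₂, h₃, ?_, ?_⟩
  · rw [hq]
    refine mul_pos (inv_pos.2 (sub_pos.2 hab)) ?_
    rw [setIntegral_pos_iff_support_of_nonneg_ae _ hIoc]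
    · have : Function.support (fun x : ℝ => x) ∩ Set.Ioc α β = Set.Ioc α β :=
        Set.inter_eq_right.2 fun x hx => (hα.trans_lt hx.1).ne'
      rw [this]
      exact (ENNReal.toReal_pos_iff.1 (levyMeasure_Ioc_pos hα hαβ)).1
    · filter_upwards [ae_restrict_mem measurableSet_Ioc] with x hx using hα.trans hx.1.le
  · have hsplit : ∫ x in Set.Iic β, x ∂(levyMeasure 1) =
        ∫ x in Set.Iic α, x ∂(levyMeasure 1) + ∫ x in Set.Ioc α β, x ∂(levyMeasure 1) := by
      rw [← Set.Iic_union_Ioc_eq_Iic hαβ.le, setIntegral_union (Set.Iic_disjoint_Ioc le_rfl)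
        measurableSet_Ioc (integrableOn_id_Iic_levyMeasure α) hIoc]
    rw [integral_shortfall, integral_shortfall, h₁, h₂, hsplit, hq,
      mul_inv_cancel_left₀ (sub_pos.2 hab).ne']
    ring

/-! ### Asymptotic linearity of the QCM estimator -/

theorem boundedInProb_of_tendsto {Ω : Type*} [MeasurableSpace Ω] {P : Measure Ω}
    [IsProbabilityMeasure P] {u : ℕ → ℝ} {l : ℝ} (h : Tendsto u atTop (𝓝 l)) :
    BoundedInProb P fun n (_ : Ω) => u n := by
  refine boundedInProb_of_abs_le (C := |l| + 1) ?_
  filter_upwards [h.abs.eventually_le_const (lt_add_one |l|)] with n hn ω using hn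

theorem tendsto_floor_mul_div {p : ℝ} (hp : 0 ≤ p) :
    Tendsto (fun n : ℕ => (⌊(n : ℝ) * p⌋₊ : ℝ) / n) atTop (𝓝 p) := by
  simpa only [mul_comm, Function.comp_def] using
    (tendsto_nat_floor_mul_div_atTop hp).comp tendsto_natCast_atTop_atTop

theorem abs_floor_sub_le {x : ℝ} (hx : 0 ≤ x) : |(⌊x⌋₊ : ℝ) - x| ≤ 1 := by
  rw [abs_le]
  constructor <;> linarith [Nat.floor_le hx, Nat.lt_floor_add_one x]

theorem floor_mul_le (n : ℕ) {p : ℝ} (hp : p ≤ 1) : ⌊(n : ℝ) * p⌋₊ ≤ n :=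
  Nat.floor_le_of_le (by nlinarith [(Nat.cast_nonneg n : (0 : ℝ) ≤ n)])

theorem tendsto_inv_sqrt : Tendsto (fun n : ℕ => (√(n : ℝ))⁻¹) atTop (𝓝 0) :=
  tendsto_inv_atTop_zero.comp (Real.tendsto_sqrt_atTop.comp tendsto_natCast_atTop_atTop)

/-- The indicator function of the half-line `(-∞, t]`. -/
noncomputable def indicatorLE (t x : ℝ) : ℝ := if x ≤ t then 1 else 0

theorem measurable_indicatorLE (t : ℝ) : Measurable (indicatorLE t) :=
  Measurable.ite measurableSet_Iic measurable_const measurable_const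

theorem memLp_indicatorLE (μ : Measure ℝ) [IsFiniteMeasure μ] (t : ℝ) (p : ENNReal) :
    MemLp (indicatorLE t) p μ := by
  refine MemLp.of_bound (measurable_indicatorLE t).aestronglyMeasurable 1 (ae_of_all _ fun x => ?_)
  unfold indicatorLE
  split_ifs <;> simp

theorem integral_indicatorLE (μ : Measure ℝ) [IsProbabilityMeasure μ] (t : ℝ) :
    ∫ x, indicatorLE t x ∂μ = cdf μ t := by
  have : indicatorLE t = (Set.Iic t).indicator 1 := by
    ext x
    simp [indicatorLE, Set.indicator_apply]
  rw [this, integral_indicator_one measurableSet_Iic, cdf_eq_real]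

section Sample

variable {Ω : Type*} {X : ℕ → Ω → ℝ}

theorem empProc_eq {ν : Measure ℝ} (h : ℝ → ℝ) (n : ℕ) (ω : Ω) :
    empProc ν h X n ω = √n * ((∑ i ∈ Finset.range n, h (X i ω)) / n - ∫ x, h x ∂ν) := by
  rcases eq_or_ne n 0 with rfl | hn
  · simp [empProc]
  have hn' : (0 : ℝ) < n := by exact_mod_cast Nat.pos_of_ne_zero hn
  have h₁ : √(n : ℝ) * √n = n := Real.mul_self_sqrt hn'.le
  have h₂ : (√(n : ℝ)) ≠ 0 := (Real.sqrt_pos.2 hn').ne'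
  rw [empProc]
  generalize √(n : ℝ) = r at *
  rw [← h₁]
  field_simp

variable [MeasurableSpace Ω] {P : Measure Ω}

theorem aemeasurable_sample (hX : ∀ i, AEMeasurable (X i) P) (n : ℕ) :
    AEMeasurable (fun ω => fun i : Fin n => X i ω) P :=
  aemeasurable_pi_lambda _ fun i => hX i

/-- The distribution function increases strictly at `q`, so by the strong law the counts at `q - ε`
and `q + ε` eventually straddle `[np]`. The deterministic bound then gives `ε` times a normalised
count that is bounded in probability. -/
theorem negligibleInProb_lowerSumDefect [IsProbabilityMeasure P]
    (hX : ∀ i, HasLaw (X i) (levyMeasure 1) P)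
    (hi : iIndepFun X P) {q p : ℝ} (hq : 0 ≤ q) (hqp : cdf (levyMeasure 1) q = p)
    (hq0 : q = 0 → p = 0) :
    NegligibleInProb P fun n ω =>
      (√n)⁻¹ * lowerSumDefect (fun i : Fin n => X i ω) q ⌊(n : ℝ) * p⌋₊ := by
  have hp : 0 ≤ p := hqp ▸ cdf_nonneg _ _
  have hp1 : p ≤ 1 := hqp ▸ cdf_le_one _ _
  rcases hq.eq_or_lt with rfl | hq
  -- No strict increase to the left of `0`; but here `k = 0` and the sample is almost surely
  -- positive, so the defect is exactly zero.
  · obtain rfl := hq0 rfl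
    refine NegligibleInProb.congr (f := fun _ _ => 0)
      (negligibleInProb_of_tendsto tendsto_const_nhds) (.of_forall fun n => ?_)
    have : ∀ᵐ ω ∂P, ∀ i, 0 < X i ω := ae_all_iff.2 fun i =>
      ((hX i).ae_iff (measurableSet_setOfPred.1 measurableSet_Ioi)).2 (ae_pos_levyMeasure 1)
    filter_upwards [this] with ω hω
    have : ∀ i : Fin n, max (-X i ω) 0 = 0 := fun i => max_eq_right (by linarith [hω i])
    simp [lowerSumDefect, this]
  -- The normalised excess count `(N - [np])/√n`: an empirical process plus a rounding error of at
  -- most `1/√n`.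
  set g : ℕ → Ω → ℝ := fun n ω =>
    empProc (levyMeasure 1) (indicatorLE q) X n ω + (√n)⁻¹ * (n * p - ⌊(n : ℝ) * p⌋₊) with hg
  have hgeq : ∀ n ω, g n ω = (√n)⁻¹ *
      ((∑ i : Fin n, if X i ω ≤ q then (1 : ℝ) else 0) - ⌊(n : ℝ) * p⌋₊) := by
    intro n ω
    simp only [hg, empProc, integral_indicatorLE, hqp, Finset.sum_range]
    simp only [indicatorLE]
    ring
  have hXm := fun i => (hX i).aemeasurable
  have hgb : BoundedInProb P g := by
    refine (boundedInProb_empProc hX hi (measurable_indicatorLE q)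
      (memLp_indicatorLE _ q 2)).add ?_
    have hb : BoundedInProb P fun n (_ : Ω) => (n * p - ⌊(n : ℝ) * p⌋₊ : ℝ) :=
      boundedInProb_of_abs_le (C := 1) (.of_forall fun n _ => by
        rw [abs_sub_comm]
        exact abs_floor_sub_le (by positivity))
    refine ((hb.mul_negligible (negligibleInProb_of_tendsto tendsto_inv_sqrt)).congr
      (.of_forall fun n => ae_of_all _ fun ω => mul_comm _ _)).boundedInProb
  refine negligibleInProb_of_ae_isLittleO (g := g) (fun n => ?_) (fun n => ?_) hgb fun ε hε => ?_
  · exact ((measurable_lowerSumDefect q _).comp_aemeasurable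
      (aemeasurable_sample hXm n)).const_mul _
  · exact (aemeasurable_empProc hX (measurable_indicatorLE q) n).add_const _
  · have hslln := fun t => strong_law_comp hX hi (measurable_indicatorLE t)
      ((memLp_indicatorLE _ t 1).integrable le_rfl)
    have h₁ : cdf (levyMeasure 1) (q - ε) < p := by
      rw [← hqp]
      exact cdf_levyMeasure_lt hq (by linarith)
    have h₂ : p < cdf (levyMeasure 1) (q + ε) := by
      rw [← hqp]
      exact cdf_levyMeasure_lt (by linarith) (by linarith)
    filter_upwards [hslln (q - ε), hslln (q + ε)] with ω hω₁ hω₂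
    rw [integral_indicatorLE] at hω₁ hω₂
    filter_upwards [hω₁.eventually_lt (tendsto_floor_mul_div hp) h₁,
      (tendsto_floor_mul_div hp).eventually_lt hω₂ h₂, eventually_gt_atTop 0] with n hn₁ hn₂ hn
    have hn' : (0 : ℝ) < n := by exact_mod_cast hn
    rw [div_lt_div_iff_of_pos_right hn', Finset.sum_range] at hn₁ hn₂
    have := abs_lowerSumDefect_le (floor_mul_le n hp1) (fun i : Fin n => X i ω) q hε.le
      hn₁.le hn₂.le
    have hs : 0 < (√(n : ℝ))⁻¹ := inv_pos.2 (Real.sqrt_pos.2 hn')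
    rw [hgeq, abs_mul, abs_mul, abs_of_pos hs, mul_left_comm]
    exact mul_le_mul_of_nonneg_left this hs.le

/-- Asymptotic linearity of the quantile-conditional-mean estimator. -/
theorem negligibleInProb_cQCM_sub [IsProbabilityMeasure P]
    (hX : ∀ i, HasLaw (X i) (levyMeasure 1) P)
    (hi : iIndepFun X P) {a b α β μ : ℝ} (ha : 0 ≤ a) (hab : a < b) (hα : 0 ≤ α) (hαβ : α < β)
    (hαa : cdf (levyMeasure 1) α = a) (hβb : cdf (levyMeasure 1) β = b) (hα0 : α = 0 → a = 0)
    (hμ : qcm (levyMeasure 1) a b = μ) (hμ0 : 0 < μ)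
    (hμ' : (b - a) * μ = b * β - a * α -
      (∫ x, shortfall β x ∂(levyMeasure 1) - ∫ x, shortfall α x ∂(levyMeasure 1))) :
    NegligibleInProb P fun n ω => √n * (cQCM a b (fun i : Fin n => X i ω) - 1) -
      ((b - a) * μ)⁻¹ * (empProc (levyMeasure 1) (shortfall α) X n ω -
        empProc (levyMeasure 1) (shortfall β) X n ω) := by
  have hb : 0 ≤ b := ha.trans hab.le
  set ka : ℕ → ℝ := fun n => (⌊(n : ℝ) * a⌋₊ : ℝ) with hka
  set kb : ℕ → ℝ := fun n => (⌊(n : ℝ) * b⌋₊ : ℝ) with hkb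
  set t : ℕ → ℝ := fun n => n / ((kb n - ka n) * μ) with ht
  have hKn : Tendsto (fun n : ℕ => (kb n - ka n) / n) atTop (𝓝 (b - a)) := by
    simpa only [sub_div] using (tendsto_floor_mul_div hb).sub (tendsto_floor_mul_div ha)
  have htlim : Tendsto t atTop (𝓝 ((b - a) * μ)⁻¹) := by
    refine ((hKn.mul_const μ).inv₀ (mul_pos (sub_pos.2 hab) hμ0).ne').congr fun n => ?_
    rw [ht, div_mul_eq_mul_div, inv_div]
  have hE := fun q => boundedInProb_empProc hX hi (measurable_shortfall q) (memLp_shortfall q 2)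
  have he : BoundedInProb P fun n ω => empProc (levyMeasure 1) (shortfall α) X n ω -
        empProc (levyMeasure 1) (shortfall β) X n ω := by
    simpa only [neg_one_mul, ← sub_eq_add_neg] using (hE α).add ((hE β).const_mul (-1))
  have htb : BoundedInProb P fun n (_ : Ω) => t n := boundedInProb_of_tendsto htlim
  have htn : NegligibleInProb P fun n (_ : Ω) => t n - ((b - a) * μ)⁻¹ :=
    negligibleInProb_of_tendsto (by simpa using htlim.sub_const ((b - a) * μ)⁻¹)
  have hfloor : ∀ p : ℝ, 0 ≤ p → NegligibleInProb P fun n (_ : Ω) =>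
      (((⌊(n : ℝ) * p⌋₊ : ℝ) - n * p) * (√n)⁻¹ : ℝ) := fun p hp =>
    BoundedInProb.mul_negligible (boundedInProb_of_abs_le (C := 1)
      (.of_forall fun n _ => abs_floor_sub_le (by positivity)))
      (negligibleInProb_of_tendsto tendsto_inv_sqrt)
  have hDa := negligibleInProb_lowerSumDefect hX hi hα hαa hα0
  have hDb := negligibleInProb_lowerSumDefect hX hi (hα.trans hαβ.le) hβb
    fun h => absurd h (hα.trans_lt hαβ).ne'
  -- Three sources of error: the normalisation `t n` in place of its limit, the rounding of `na` and
  -- `nb`, and the two defects.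
  have hrem := (he.mul_negligible htn).add (htb.mul_negligible
    ((((hfloor b hb).const_mul (β - μ)).add ((hfloor a ha).const_mul (-(α - μ)))).add
      (hDb.add (hDa.const_mul (-1)))))
  refine hrem.congr ?_
  filter_upwards [hKn.eventually_const_lt (sub_pos.2 hab), eventually_gt_atTop 0] with n hK hn
  refine ae_of_all _ fun ω => ?_
  have hn' : (0 : ℝ) < n := by exact_mod_cast hn
  have hK' : 0 < kb n - ka n := by
    by_contra! h
    exact (div_nonpos_of_nonpos_of_nonneg h hn'.le).not_gt hK
  have hle : ⌊(n : ℝ) * a⌋₊ ≤ ⌊(n : ℝ) * b⌋₊ := Nat.floor_mono (by gcongr)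
  have hs : 0 < √(n : ℝ) := Real.sqrt_pos.2 hn'
  have hss : √(n : ℝ) ^ 2 = n := Real.sq_sqrt hn'.le
  have hsum : ∀ q, ∑ i : Fin n, max (q - X i ω) 0 =
      √n * empProc (levyMeasure 1) (shortfall q) X n ω +
        n * ∫ x, shortfall q x ∂(levyMeasure 1) := by
    intro q
    rw [empProc, mul_inv_cancel_left₀ hs.ne', sub_add_cancel, Finset.sum_range]
    rfl
  rw [cQCM, sampleQCM, sum_orderStat_between hle _ α β, hsum, hsum, hμ]
  set Da := lowerSumDefect (fun i : Fin n => X i ω) α ⌊(n : ℝ) * a⌋₊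
  set Db := lowerSumDefect (fun i : Fin n => X i ω) β ⌊(n : ℝ) * b⌋₊
  set ea := empProc (levyMeasure 1) (shortfall α) X n ω
  set eb := empProc (levyMeasure 1) (shortfall β) X n ω
  set Ia := ∫ x, shortfall α x ∂(levyMeasure 1)
  set Ib := ∫ x, shortfall β x ∂(levyMeasure 1)
  change _ = √n * (1 / (kb n - ka n) * (kb n * β - ka n * α - (√n * eb + n * Ib -
    (√n * ea + n * Ia)) + (Db - Da)) / μ - 1) - _
  -- The population identity `hμ'`, multiplied by `n`, cancels the deterministic part of order `n`.
  have hkey : kb n * β - ka n * α - (√n * eb + n * Ib - (√n * ea + n * Ia)) + (Db - Da) =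
      (kb n - ka n) * μ + ((kb n - n * b) * (β - μ) - (ka n - n * a) * (α - μ) +
        √n * (ea - eb) + (Db - Da)) := by
    linear_combination (-(n : ℝ)) * hμ'
  rw [hkey, ht]
  have hK0 := hK'.ne'
  have hμ0' := hμ0.ne'
  have hs0 := hs.ne'
  have hba : b - a ≠ 0 := (sub_pos.2 hab).ne'
  generalize ((b - a) * μ)⁻¹ = κ
  change (ea - eb) * (n / ((kb n - ka n) * μ) - κ) + n / ((kb n - ka n) * μ) * ((β - μ) * ((kb n - n * b) * (√n)⁻¹) +
    -(α - μ) * ((ka n - n * a) * (√n)⁻¹) + ((√n)⁻¹ * Db + -1 * ((√n)⁻¹ * Da))) = _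
  generalize kb n - ka n = K at *
  generalize kb n - n * b = B
  generalize ka n - n * a = A
  generalize √(n : ℝ) = r at *
  rw [← hss]
  field_simp
  ring

end Sample

/-! ### The covariance estimator and the influence function -/

theorem sampleMean_eq_sum_range (u : ℕ → ℝ) (n : ℕ) :
    sampleMean (fun i : Fin n => u i) = (∑ i ∈ Finset.range n, u i) / n := by
  rw [sampleMean, Finset.sum_range]

/-- Recentring at the population means leaves an i.i.d. average and a product of two small
deviations, which is negligible after multiplication by `√n`. -/
theorem sum_sub_sampleMean_mul {n : ℕ} (hn : n ≠ 0) (y z : Fin n → ℝ) (s t : ℝ) :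
    ∑ i, (y i - sampleMean y) * (z i - sampleMean z) =
      n * (sampleMean (fun i => (y i - s) * (z i - t)) -
        (sampleMean y - s) * (sampleMean z - t)) := by
  have hn' : (n : ℝ) ≠ 0 := by exact_mod_cast hn
  have hy : ∑ i, y i = n * sampleMean y := by rw [sampleMean]; field_simp
  have hz : ∑ i, z i = n * sampleMean z := by rw [sampleMean]; field_simp
  have h : n * sampleMean (fun i => (y i - s) * (z i - t)) = ∑ i, (y i - s) * (z i - t) := by
    rw [sampleMean]; field_simp
  rw [mul_sub, h]
  simp only [sub_mul, mul_sub, Finset.sum_sub_distrib, ← Finset.mul_sum, ← Finset.sum_mul,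
    Finset.sum_const, Finset.card_univ, Fintype.card_fin, nsmul_eq_mul, hy, hz]
  ring

/-- The mean of `ln (1 / W)` for a standard Lévy variable `W`. -/
noncomputable def meanLog : ℝ := ∫ x, Real.log (1 / x) ∂(levyMeasure 1)

/-- The product of the centred reciprocal and the centred log-reciprocal. -/
noncomputable def crossTerm (x : ℝ) : ℝ := (1 / x - 1) * (Real.log (1 / x) - meanLog)

theorem measurable_crossTerm : Measurable crossTerm := by
  unfold crossTerm
  fun_prop

theorem memLp_crossTerm : MemLp crossTerm 2 (levyMeasure 1) :=
  (memLp_log_one_div.sub (memLp_const meanLog)).mul' (memLp_one_div.sub (memLp_const 1))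
    (hpqr := ⟨by
      rw [show (4 : ENNReal) = 2 * 2 by norm_num,
        ENNReal.mul_inv (by simp) (by simp), ← mul_add, ENNReal.inv_two_add_inv_two, mul_one]⟩)

theorem memLp_two_one_div : MemLp (fun x : ℝ => 1 / x) 2 (levyMeasure 1) :=
  memLp_one_div.mono_exponent (by norm_num)

theorem integrable_log_one_div : Integrable (fun x : ℝ => Real.log (1 / x)) (levyMeasure 1) :=
  memLp_log_one_div.integrable (by norm_num)

theorem integral_crossTerm : ∫ x, crossTerm x ∂(levyMeasure 1) = 2 := by
  have h₁ : Integrable (fun x : ℝ => meanLog * (1 / x - 1)) (levyMeasure 1) :=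
    ((memLp_two_one_div.integrable (by norm_num)).sub (integrable_const 1)).const_mul _
  have h₂ : (fun x : ℝ => (1 / x - 1) * Real.log (1 / x)) =
      fun x => crossTerm x + meanLog * (1 / x - 1) := by
    ext x
    rw [crossTerm]
    ring
  have h₃ := integral_mul_log
  rw [h₂, integral_add (memLp_crossTerm.integrable (by norm_num)) h₁, integral_const_mul,
    integral_sub (memLp_two_one_div.integrable (by norm_num)) (integrable_const 1),
    integral_one_div] at h₃
  simpa using h₃

/-- The influence function of the ensemble scale ratio statistic, up to an additive constant. -/
noncomputable def influence (κ α β x : ℝ) : ℝ :=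
  1 / 2 * (2 * (1 / x) - 1 / 2 * crossTerm x + κ * (shortfall α x - shortfall β x))

theorem measurable_influence (κ α β : ℝ) : Measurable (influence κ α β) := by
  have := measurable_crossTerm
  have := measurable_shortfall
  unfold influence
  fun_prop

theorem memLp_influence (κ α β : ℝ) : MemLp (influence κ α β) 2 (levyMeasure 1) :=
  (((memLp_two_one_div.const_mul 2).sub (memLp_crossTerm.const_mul (1 / 2))).add
    (((memLp_shortfall α 2).sub (memLp_shortfall β 2)).const_mul κ)).const_mul (1 / 2)

/-- At infinity the shortfalls vanish and `1/x - 1` tends to `-1`, so `crossTerm` grows like `ln x`;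
it enters with coefficient `-1/4`. -/
theorem tendsto_influence_atTop (κ α β : ℝ) : Tendsto (influence κ α β) atTop atBot := by
  have h₁ : Tendsto (fun x : ℝ => 1 / x) atTop (𝓝 0) := by
    simpa only [one_div] using tendsto_inv_atTop_zero
  have h₂ : Tendsto (fun x : ℝ => Real.log (1 / x) - meanLog) atTop atBot := by
    have : Tendsto (fun x : ℝ => -Real.log x - meanLog) atTop atBot :=
      tendsto_atBot_add_const_right _ _ (tendsto_neg_atTop_atBot.comp Real.tendsto_log_atTop)
    simpa only [one_div, Real.log_inv] using this
  have h₃ : Tendsto crossTerm atTop atTop :=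
    Tendsto.neg_mul_atBot (C := 0 - 1) (by norm_num) (h₁.sub_const 1) h₂
  have h₄ : Tendsto (fun x : ℝ => 1 / x - 1 / 4 * crossTerm x) atTop atBot := by
    have := h₁.add_atBot (tendsto_neg_atTop_atBot.comp
      (h₃.const_mul_atTop (show (0 : ℝ) < 1 / 4 by norm_num)))
    simpa only [Function.comp_def, ← sub_eq_add_neg] using this
  refine h₄.congr' ?_
  filter_upwards [eventually_ge_atTop α, eventually_ge_atTop β] with x hα hβ
  rw [influence, shortfall, shortfall, max_eq_right (by linarith), max_eq_right (by linarith)]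
  ring

/-- Zero variance would make `influence` almost surely equal to its mean, but far out it lies
strictly below, on an interval of positive mass. -/
theorem variance_influence_pos (κ α β : ℝ) : 0 < Var[influence κ α β; levyMeasure 1] := by
  refine lt_of_le_of_ne (variance_nonneg _ _) fun h => ?_
  have hae := ae_eq_integral_of_variance_eq_zero (memLp_influence κ α β) h.symm
  obtain ⟨t, ht⟩ := eventually_atTop.1 ((tendsto_influence_atTop κ α β).eventually_lt_atBot
    (∫ x, influence κ α β x ∂(levyMeasure 1)))
  have hpos := levyMeasure_Ioc_pos (le_max_right t 0) (lt_add_one (max t 0))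
  have hzero : levyMeasure 1 (Set.Ioc (max t 0) (max t 0 + 1)) = 0 := by
    refine measure_mono_null (fun x hx => ?_) (ae_iff.1 hae)
    exact (ht x ((le_max_left t 0).trans hx.1.le)).ne
  rw [measureReal_def, hzero] at hpos
  exact lt_irrefl _ hpos

/-! ### Linearisation of the ensemble statistic -/

section Sample

variable {Ω : Type*} {X : ℕ → Ω → ℝ}

theorem empProc_influence (κ α β : ℝ) (n : ℕ) (ω : Ω) :
    empProc (levyMeasure 1) (influence κ α β) X n ω =
      1 / 2 * (2 * empProc (levyMeasure 1) (fun x => 1 / x) X n ω -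
        1 / 2 * empProc (levyMeasure 1) crossTerm X n ω +
        κ * (empProc (levyMeasure 1) (shortfall α) X n ω -
          empProc (levyMeasure 1) (shortfall β) X n ω)) := by
  have h₁ := memLp_two_one_div.integrable (by norm_num)
  have h₂ := memLp_crossTerm.integrable (by norm_num)
  have h₃ := fun q => (memLp_shortfall q 1).integrable le_rfl
  have hint : ∫ x, influence κ α β x ∂(levyMeasure 1) =
      1 / 2 * (2 * ∫ x, 1 / x ∂(levyMeasure 1) - 1 / 2 * ∫ x, crossTerm x ∂(levyMeasure 1) +
        κ * (∫ x, shortfall α x ∂(levyMeasure 1) - ∫ x, shortfall β x ∂(levyMeasure 1))) := by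
    unfold influence
    have h₄ : Integrable (fun x => 2 * (1 / x) - 1 / 2 * crossTerm x) (levyMeasure 1) :=
      (h₁.const_mul 2).sub (h₂.const_mul (1 / 2))
    have h₅ : Integrable (fun x => κ * (shortfall α x - shortfall β x)) (levyMeasure 1) :=
      ((h₃ α).sub (h₃ β)).const_mul κ
    rw [integral_const_mul, integral_add h₄ h₅, integral_sub (h₁.const_mul 2) (h₂.const_mul (1 / 2)),
      integral_const_mul, integral_const_mul, integral_const_mul, integral_sub (h₃ α) (h₃ β)]
  simp only [empProc, hint]
  simp only [influence, ← Finset.mul_sum, Finset.sum_add_distrib, Finset.sum_sub_distrib]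
  ring

/-- The plug-in sample covariance of the reciprocals and the log-reciprocals. -/
noncomputable def sampleCov (X : ℕ → Ω → ℝ) (n : ℕ) (ω : Ω) : ℝ :=
  (∑ i ∈ Finset.range n, crossTerm (X i ω)) / n -
    ((∑ i ∈ Finset.range n, 1 / X i ω) / n - 1) *
      ((∑ i ∈ Finset.range n, Real.log (1 / X i ω)) / n - meanLog)

theorem ensembleStat_eq (a b : ℝ) {n : ℕ} (hn : n ≠ 0) (ω : Ω) :
    ensembleStat a b (fun i : Fin n => X i ω) =
      √n * (((2 / sampleCov X n ω + cQCM a b (fun i : Fin n => X i ω)) *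
        ((∑ i ∈ Finset.range n, 1 / X i ω) / n)) / 2 - 1) := by
  have hn' : (n : ℝ) ≠ 0 := by exact_mod_cast hn
  have hcov : cCOV (fun i : Fin n => X i ω) = 2 / sampleCov X n ω := by
    simp only [cCOV]
    rw [sum_sub_sampleMean_mul hn _ _ 1 meanLog, sampleMean_eq_sum_range (fun i => 1 / X i ω),
      sampleMean_eq_sum_range (fun i => Real.log (1 / X i ω)),
      sampleMean_eq_sum_range (fun i => (1 / X i ω - 1) * (Real.log (1 / X i ω) - meanLog)),
      mul_comm (2 : ℝ), mul_div_mul_left _ _ hn']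
    rfl
  rw [ensembleStat, hcov, cMLE, sampleMean_eq_sum_range (fun i => 1 / X i ω), mul_one_div,
    div_div_eq_mul_div]

/-- Asymptotic linearity of the ensemble scale ratio statistic. -/
theorem negligibleInProb_ensembleStat_sub [MeasurableSpace Ω] {P : Measure Ω} [IsProbabilityMeasure P]
    (hX : ∀ i, HasLaw (X i) (levyMeasure 1) P)
    (hi : iIndepFun X P) {a b α β : ℝ} (ha : 0 ≤ a) (hab : a < b) (hα : 0 ≤ α) (hαβ : α < β)
    (hαa : cdf (levyMeasure 1) α = a) (hβb : cdf (levyMeasure 1) β = b) (hα0 : α = 0 → a = 0)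
    (hμ0 : 0 < qcm (levyMeasure 1) a b)
    (hμ : (b - a) * qcm (levyMeasure 1) a b = b * β - a * α -
      (∫ x, shortfall β x ∂(levyMeasure 1) - ∫ x, shortfall α x ∂(levyMeasure 1))) :
    NegligibleInProb P fun n ω => ensembleStat a b (fun i : Fin n => X i ω) -
      empProc (levyMeasure 1) (influence ((b - a) * qcm (levyMeasure 1) a b)⁻¹ α β) X n ω := by
  have hXm := fun i => (hX i).aemeasurable
  have hmy : Measurable fun x : ℝ => 1 / x := by fun_prop
  have hmz : Measurable fun x : ℝ => Real.log (1 / x) := by fun_prop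
  have hmc := measurable_crossTerm
  set κ := ((b - a) * qcm (levyMeasure 1) a b)⁻¹ with hκ
  set Q : ℕ → Ω → ℝ := fun n ω => cQCM a b (fun i : Fin n => X i ω) with hQ
  set U := empProc (levyMeasure 1) (fun x => 1 / x) X with hU
  set V := empProc (levyMeasure 1) crossTerm X with hV
  set E : ℕ → Ω → ℝ := fun n ω => empProc (levyMeasure 1) (shortfall α) X n ω -
    empProc (levyMeasure 1) (shortfall β) X n ω with hE
  set D : ℕ → Ω → ℝ := fun n ω =>
    (∑ i ∈ Finset.range n, Real.log (1 / X i ω)) / n - meanLog with hD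
  set S := sampleCov X with hS
  have hUb : BoundedInProb P U := boundedInProb_empProc hX hi hmy memLp_two_one_div
  have hVb : BoundedInProb P V := boundedInProb_empProc hX hi hmc memLp_crossTerm
  have hEb : BoundedInProb P E := by
    have := fun q => boundedInProb_empProc hX hi (measurable_shortfall q) (memLp_shortfall q 2)
    simpa only [hE, neg_one_mul, ← sub_eq_add_neg] using (this α).add ((this β).const_mul (-1))
  have hR : NegligibleInProb P fun n ω => √n * (Q n ω - 1) - κ * E n ω :=
    negligibleInProb_cQCM_sub hX hi ha hab hα hαβ hαa hβb hα0 rfl hμ0 hμ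
  have hlawY := strong_law_comp hX hi hmy (memLp_two_one_div.integrable (by norm_num))
  have hlawZ := strong_law_comp hX hi hmz integrable_log_one_div
  have hlawC := strong_law_comp hX hi hmc (memLp_crossTerm.integrable (by norm_num))
  rw [integral_one_div] at hlawY
  rw [integral_crossTerm] at hlawC
  have hDlim : ∀ᵐ ω ∂P, Tendsto (fun n => D n ω) atTop (𝓝 0) := by
    filter_upwards [hlawZ] with ω h
    simpa [hD, meanLog] using h.sub_const meanLog
  have hSlim : ∀ᵐ ω ∂P, Tendsto (fun n => S n ω) atTop (𝓝 2) := by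
    filter_upwards [hlawY, hlawC, hDlim] with ω h₁ h₂ h₃
    have := h₂.sub ((h₁.sub_const 1).mul h₃)
    rwa [mul_zero, sub_zero] at this
  have hDm : ∀ n, AEMeasurable (D n) P := fun n => by
    simp only [hD]
    fun_prop
  have hSm : ∀ n, AEMeasurable (S n) P := fun n => by
    simp only [hS]
    unfold sampleCov
    fun_prop
  have hDn : NegligibleInProb P D := negligibleInProb_of_ae_tendsto hDm hDlim
  have hSn : NegligibleInProb P fun n ω => (S n ω)⁻¹ - 1 / 2 := by
    refine negligibleInProb_of_ae_tendsto (fun n => (hSm n).inv.sub_const _) ?_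
    filter_upwards [hSlim] with ω h
    simpa using (h.inv₀ two_ne_zero).sub_const (1 / 2)
  have hQn : NegligibleInProb P fun n ω => Q n ω - 1 := by
    refine (((hEb.const_mul κ).add hR.boundedInProb).mul_negligible
      (negligibleInProb_of_tendsto tendsto_inv_sqrt)).congr ?_
    filter_upwards [eventually_gt_atTop 0] with n hn
    refine ae_of_all _ fun ω => ?_
    have : √(n : ℝ) ≠ 0 := (Real.sqrt_pos.2 (by exact_mod_cast hn)).ne'
    field_simp
    ring
  -- `S * S⁻¹ = 1` fails where `S = 0`. This term absorbs that event, so that the decomposition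
  -- below holds for every `ω`.
  have hnull : NegligibleInProb P fun n ω => √n * (S n ω * (S n ω)⁻¹ - 1) := by
    refine negligibleInProb_of_ae_tendsto
      (fun n => (((hSm n).mul (hSm n).inv).sub_const _).const_mul _) ?_
    filter_upwards [hSlim] with ω h
    refine tendsto_const_nhds.congr' ?_
    filter_upwards [h.eventually_ne two_ne_zero] with n hn
    rw [mul_inv_cancel₀ hn, sub_self, mul_zero]
  have hUD : NegligibleInProb P fun n ω => U n ω * D n ω := hUb.mul_negligible hDn
  have hA : BoundedInProb P fun n ω => 2 * U n ω + (-1 * V n ω + U n ω * D n ω) :=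
    (hUb.const_mul 2).add ((hVb.const_mul (-1)).add hUD.boundedInProb)
  -- The remainder collects the replacement of `1/S` by `1/2`, the product of the two centred means,
  -- the event `S = 0`, the product `U (Q - 1)`, and the QCM remainder.
  refine ((((hA.mul_negligible hSn).add (hUD.const_mul (1 / 2))).add
    (hnull.add ((hUb.mul_negligible hQn).add hR))).const_mul (1 / 2)).congr ?_
  filter_upwards [eventually_gt_atTop 0] with n hn
  refine ae_of_all _ fun ω => ?_
  rw [ensembleStat_eq a b hn.ne', empProc_influence]
  have hUe : U n ω = √n * ((∑ i ∈ Finset.range n, 1 / X i ω) / n - 1) := by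
    rw [hU, empProc_eq, integral_one_div]
  have hVe : V n ω = √n * ((∑ i ∈ Finset.range n, crossTerm (X i ω)) / n - 2) := by
    rw [hV, empProc_eq, integral_crossTerm]
  have hSe : √n * (S n ω - 2) = V n ω - U n ω * D n ω := by
    rw [hUe, hVe, hS, sampleCov]
    ring
  change _ = √n * (((2 / S n ω + Q n ω) * _) / 2 - 1) - 1 / 2 * (2 * U n ω - 1 / 2 * V n ω +
    κ * E n ω)
  generalize (∑ i ∈ Finset.range n, 1 / X i ω) / (n : ℝ) = y at *
  generalize S n ω = s at *
  rw [div_eq_mul_inv 2 s]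
  generalize s⁻¹ = r at *
  generalize √(n : ℝ) = w at *
  generalize V n ω = v at *
  generalize U n ω = u at *
  subst hUe
  linear_combination (1 / 2 * r) * hSe

end Sample

/-- Asymptotic normality of the ensemble scale ratio statistic at scale one. -/
theorem tendstoInDistribution_ensembleStat {Ω : Type*} [MeasurableSpace Ω] {P : Measure Ω}
    [IsProbabilityMeasure P] {X : ℕ → Ω → ℝ} (hX : ∀ i, HasLaw (X i) (levyMeasure 1) P)
    (hi : iIndepFun X P) {a b α β : ℝ} (ha : 0 ≤ a) (hab : a < b) (hα : 0 ≤ α) (hαβ : α < β)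
    (hαa : cdf (levyMeasure 1) α = a) (hβb : cdf (levyMeasure 1) β = b) (hα0 : α = 0 → a = 0)
    (hμ0 : 0 < qcm (levyMeasure 1) a b)
    (hμ : (b - a) * qcm (levyMeasure 1) a b = b * β - a * α -
      (∫ x, shortfall β x ∂(levyMeasure 1) - ∫ x, shortfall α x ∂(levyMeasure 1))) :
    TendstoInDistribution
      (fun (n : ℕ) (ω : Ω) => ensembleStat a b (fun i : Fin n => X i ω)) atTop (id : ℝ → ℝ)
      (fun _ => P) (gaussianReal 0
        Var[influence ((b - a) * qcm (levyMeasure 1) a b)⁻¹ α β; levyMeasure 1].toNNReal) :=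
  tendstoInDistribution_of_tendstoInMeasure_sub _ _
    (tendstoInDistribution_empProc hX hi (measurable_influence _ α β) (memLp_influence _ α β))
    (negligibleInProb_iff.1
      (negligibleInProb_ensembleStat_sub hX hi ha hab hα hαβ hαa hβb hα0 hμ0 hμ))
    fun n => (measurable_ensembleStat a b).comp_aemeasurable
      (aemeasurable_sample (fun i => (hX i).aemeasurable) n)

end LevyGoF

theorem proposition3p3 (a b : ℝ) (ha : 0 ≤ a) (hab : a < b) (hb : b < 1) :
    ∃ τ : ℝ≥0, 0 < τ ∧
      ∀ (c : ℝ), 0 < c →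
      ∀ (Ω : Type*) [MeasurableSpace Ω] (P : Measure Ω) [IsProbabilityMeasure P]
        (X : ℕ → Ω → ℝ),
        (∀ i, HasLaw (X i) (LevyGoF.levyMeasure c) P) →
        iIndepFun X P →
        TendstoInDistribution
          (fun (n : ℕ) (ω : Ω) => LevyGoF.ensembleStat a b (fun i : Fin n => X i ω))
          atTop (id : ℝ → ℝ) (fun _ => P) (gaussianReal 0 (τ ^ 2)) := by
  obtain ⟨α, β, hα, hαβ, hαa, hβb, hα0, hμ0, hμ⟩ := LevyGoF.exists_quantiles_qcm ha hab hb
  set v := Var[LevyGoF.influence ((b - a) * LevyGoF.qcm (LevyGoF.levyMeasure 1) a b)⁻¹ α β;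
    LevyGoF.levyMeasure 1] with hv
  have hvpos : 0 < v := LevyGoF.variance_influence_pos _ α β
  refine ⟨NNReal.sqrt v.toNNReal, NNReal.sqrt_pos.2 (Real.toNNReal_pos.2 hvpos), ?_⟩
  intro c hc Ω _ P _ X hX hi
  have hm : Measurable fun x : ℝ => c⁻¹ * x := measurable_const_mul _
  have hlaw : HasLaw (fun x : ℝ => c⁻¹ * x) (LevyGoF.levyMeasure 1) (LevyGoF.levyMeasure c) :=
    ⟨hm.aemeasurable, LevyGoF.map_mul_levyMeasure hc⟩
  have hX' : ∀ i, HasLaw (fun ω => c⁻¹ * X i ω) (LevyGoF.levyMeasure 1) P := fun i =>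
    hlaw.comp (hX i)
  have h := LevyGoF.tendstoInDistribution_ensembleStat hX'
    (hi.comp (fun _ x => c⁻¹ * x) fun _ => hm) ha hab hα hαβ hαa hβb hα0 hμ0 hμ
  rw [NNReal.sq_sqrt]
  -- The rescaled sample `c⁻¹ X` has law `Lv(1)`; scale invariance needs nonzero values, which holds
  -- almost surely.
  refine h.congr (fun n => ?_) (ae_eq_refl _)
  have hpos : ∀ᵐ ω ∂P, ∀ i, 0 < X i ω := ae_all_iff.2 fun i =>
    ((hX i).ae_iff (measurableSet_setOfPred.1 measurableSet_Ioi)).2 (LevyGoF.ae_pos_levyMeasure c)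
  filter_upwards [hpos] with ω hω
  exact LevyGoF.ensembleStat_const_mul a b _ (inv_pos.2 hc) fun i => (hω i).ne'
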